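/- Let $\ell\ge 0$. For $\underline p=(p_1,\dots,p_{\ell+1})\in\mathbb Z^{\ell+1}$ let $\mathcal P(\underline p)$ be the finite set of Gelfand–Zetlin patterns with top row $\underline p$, i.e. of integer arrays $(p_{k,i})_{1\le i\le k\le \ell+1}$ with $p_{\ell+1,i}=p_i$ and $p_{k+1,i}\le p_{k,i}\le p_{k+1,i+1}$ for $1\le i\le k\le\ell$; put $s_k=\sum_{i=1}^k p_{k,i}$, $s_0=0$. For $0<q<1$ let $(n)_q!=(1-q)(1-q^2)\cdots(1-q^n)$. For $\underline\lambda\in\mathbb C^{\ell+1}$ the $q$-deformed $\mathfrak{gl}_{\ell+1}$-Whittaker function is $$\Psi_{\underline\lambda}(\underline p)=\sum_{(p_{k,i})\in\mathcal P(\underline p)}\ \prod_{k=1}^{\ell+1}q^{\lambda_k(s_k-s_{k-1})}\cdot\frac{\prod_{k=2}^{\ell}\prod_{i=1}^{k-1}(p_{k,i+1}-p_{k,i})_q!}{\prod_{k=1}^{\ell}\prod_{i=1}^{k}(p_{k,i}-p_{k+1,i})_q!\,(p_{k+1,i+1}-p_{k,i})_q!}$$ if $p_1\le\dots\le p_{\ell+1}$,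 and $\Psi_{\underline\lambda}(\underline p)=0$ otherwise. For $\underline z\in(\mathbb C^*)^{\ell+1}$ put $$\chi_{\underline p}(\underline z)=\sum_{(p_{k,i})\in\mathcal P(\underline p)}\ \prod_{k=1}^{\ell+1}z_k^{\,s_k-s_{k-1}}$$ if $p_1\le\dots\le p_{\ell+1}$, and $\chi_{\underline p}(\underline z)=0$ otherwise. Let $\underline p\in\mathbb Z^{\ell+1}$ with $p_1\le\dots\le p_{\ell+1}$. Then: 1. For every $\underline z\in(\mathbb C^*)^{\ell+1}$, if $q\to0^+$ and $\underline\lambda=\underline\lambda(q)\in\mathbb C^{\ell+1}$ varies with $q$ so that $q^{\lambda_i}=z_i$ stays fixed for $i=1,\dots,\ell+1$, then $\Psi_{\underline\lambda}(\underline p)\to\chi_{\underline p}(\underline z)$. 2. For $1\le r\le\ell+1$ let $\chi_r(\underline z)$ be the character of the fundamental representation $\bigwedge^r\mathbb C^{\ell+1}$ at $\mathrm{diag}(z_1,\dots,z_{\ell+1})$. Then, for every $\underline z\in(\mathbb C^*)^{\ell+1}$, $\chi_r(\underline z)=e_r(\underline z)=\sum_{I}\prod_{i\in I}z_i$ and $$\chi_r(\underline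 z)\,\chi_{\underline p}(\underline z)=\sum_{I}\chi_{\underline p+I}(\underline z),$$ where both sums are over the subsets $I\subset\{1,\dots,\ell+1\}$ with $r$ elements, and $\underline p+I$ is obtained from $\underline p$ by adding $1$ to the coordinates $p_i$, $i\in I$. 3. There is an irreducible finite-dimensional rational representation of $GL_{\ell+1}(\mathbb C)$ with highest weight $(p_{\ell+1},p_\ell,\dots,p_1)$ (with respect to the upper triangular Borel subgroup), and every such representation has character $\chi_{\underline p}$: the trace of $\mathrm{diag}(z_1,\dots,z_{\ell+1})$ in it equals $\chi_{\underline p}(\underline z)$ for all $\underline z\in(\mathbb C^*)^{\ell+1}$. -/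

import Mathlib

open Filter Topology

namespace QWhittaker

/-- Gelfand–Zetlin patterns with top row `p`. A pattern is a triangular array of integers `P k i`,
`1 ≤ i ≤ k ≤ ℓ + 1`, extended by zero to all of `ℕ × ℕ`; the interlacing conditions are
`P (k+1) i ≤ P k i ≤ P (k+1) (i+1)`. The top row is `P (ℓ+1) (i+1) = p i` for `i : Fin (ℓ+1)`. -/
def gzPatterns (ℓ : ℕ) (p : Fin (ℓ + 1) → ℤ) : Set (ℕ → ℕ → ℤ) :=
  {P | (∀ i : Fin (ℓ + 1), P (ℓ + 1) (i + 1) = p i) ∧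
    (∀ k i, 1 ≤ i → i ≤ k → k ≤ ℓ → P (k + 1) i ≤ P k i ∧ P k i ≤ P (k + 1) (i + 1)) ∧
    (∀ k i, ¬ (1 ≤ i ∧ i ≤ k ∧ k ≤ ℓ + 1) → P k i = 0)}

theorem gzPatterns_finite (ℓ : ℕ) (p : Fin (ℓ + 1) → ℤ) : (gzPatterns ℓ p).Finite := by
  set B : ℤ := ∑ i, |p i| with hB
  have hB0 : 0 ≤ B := Finset.sum_nonneg fun i _ => abs_nonneg _
  let F : (Fin (ℓ + 2) → Fin (ℓ + 2) → ℤ) → (ℕ → ℕ → ℤ) := fun f k i =>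
    if h : k < ℓ + 2 ∧ i < ℓ + 2 then f ⟨k, h.1⟩ ⟨i, h.2⟩ else 0
  refine ((Set.finite_Icc (fun _ _ => -B) (fun _ _ => B)).image F).subset ?_
  rintro P ⟨htop, hint, hzero⟩
  have key : ∀ d k, k + d = ℓ + 1 → ∀ i, 1 ≤ i → i ≤ k → -B ≤ P k i ∧ P k i ≤ B := by
    intro d
    induction d with
    | zero =>
      intro k hk i hi1 hik
      have hk' : k = ℓ + 1 := by omega
      subst hk'
      have h := htop ⟨i - 1, by omega⟩
      have hi : i - 1 + 1 = i := by omega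
      simp only [hi] at h
      rw [h]
      have h2 : |p ⟨i - 1, by omega⟩| ≤ B :=
        Finset.single_le_sum (f := fun j => |p j|) (fun j _ => abs_nonneg _) (Finset.mem_univ _)
      exact abs_le.mp h2
    | succ d ih =>
      intro k hk i hi1 hik
      have h1 := ih (k + 1) (by omega) i hi1 (by omega)
      have h2 := ih (k + 1) (by omega) (i + 1) (by omega) (by omega)
      have h3 := hint k i hi1 hik (by omega)
      constructor <;> linarith [h1.1, h2.2, h3.1, h3.2]
  have bd : ∀ k i, -B ≤ P k i ∧ P k i ≤ B := by
    intro k i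
    by_cases h : 1 ≤ i ∧ i ≤ k ∧ k ≤ ℓ + 1
    · exact key (ℓ + 1 - k) k (by omega) i h.1 h.2.1
    · rw [hzero k i h]; constructor <;> linarith
  refine ⟨fun k i => P k i, ⟨fun k i => (bd k i).1, fun k i => (bd k i).2⟩, ?_⟩
  funext k i
  by_cases h : k < ℓ + 2 ∧ i < ℓ + 2
  · simp [F, h]
  · simp only [F, h, dite_false]
    exact (hzero k i (by omega)).symm

/-- The sum `∑_{i=1}^k P_{k,i}` of the `k`-th row (zero for `k = 0`). -/
def rowSum (P : ℕ → ℕ → ℤ) (k : ℕ) : ℤ := ∑ i ∈ Finset.Icc 1 k, P k i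

/-- `(n)_q! = (1 - q) ⋯ (1 - q ^ n)`; it is only used for `n ≥ 0`. -/
def qFactorial (q : ℝ) (n : ℤ) : ℝ := ∏ j ∈ Finset.Icc 1 n.toNat, (1 - q ^ j)

/-- The ratio of `q`-factorials with which a pattern is weighted in the `q`-Whittaker function. -/
noncomputable def qWeight (ℓ : ℕ) (q : ℝ) (P : ℕ → ℕ → ℤ) : ℝ :=
  (∏ k ∈ Finset.Icc 2 ℓ, ∏ i ∈ Finset.Icc 1 (k - 1), qFactorial q (P k (i + 1) - P k i)) /
    ∏ k ∈ Finset.Icc 1 ℓ, ∏ i ∈ Finset.Icc 1 k,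
      (qFactorial q (P k i - P (k + 1) i) * qFactorial q (P (k + 1) (i + 1) - P k i))

open Classical in
/-- The `q`-deformed `𝔤𝔩_{ℓ+1}`-Whittaker function `Ψ_λ(p)` on the lattice `ℤ^{ℓ+1}`. The spectral
parameters may be complex; `lam k` stands for `λ_{k+1}`. -/
noncomputable def qWhittakerFun (ℓ : ℕ) (q : ℝ) (lam : Fin (ℓ + 1) → ℂ) (p : Fin (ℓ + 1) → ℤ) :
    ℂ :=
  if Monotone p then
    ∑ P ∈ (gzPatterns_finite ℓ p).toFinset,
      (∏ k : Fin (ℓ + 1), (q : ℂ) ^ (lam k * ((rowSum P (k + 1) - rowSum P k : ℤ) : ℂ))) *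
        (qWeight ℓ q P : ℂ)
  else 0

open Classical in
/-- The Gelfand–Zetlin generating sum `χ_p(z)` for `p_1 ≤ ⋯ ≤ p_{ℓ+1}`, zero for other `p`. -/
noncomputable def gzChar (ℓ : ℕ) (p : Fin (ℓ + 1) → ℤ) (z : Fin (ℓ + 1) → ℂˣ) : ℂ :=
  if Monotone p then
    ∑ P ∈ (gzPatterns_finite ℓ p).toFinset,
      ∏ k : Fin (ℓ + 1), (z k : ℂ) ^ (rowSum P (k + 1) - rowSum P k)
  else 0

/-- The character of the fundamental representation `⋀^r ℂ^n` at the diagonal matrix of `z`. -/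
noncomputable def fundChar {n : ℕ} (r : ℕ) (z : Fin n → ℂˣ) : ℂ :=
  LinearMap.trace ℂ (⋀[ℂ]^r (Fin n → ℂ))
    (exteriorPower.map r (Matrix.toLin' (Matrix.diagonal fun i => (z i : ℂ))))

/-- The element `p + I` of the lattice: `1` is added to the coordinates in `I`. -/
def shift {n : ℕ} (p : Fin n → ℤ) (I : Finset (Fin n)) : Fin n → ℤ :=
  fun i => p i + if i ∈ I then 1 else 0

/-- The diagonal matrix of `z` as an element of `GL_n(ℂ)`. -/
noncomputable def torusElt {n : ℕ} (z : Fin n → ℂˣ) : Matrix.GeneralLinearGroup (Fin n) ℂ :=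
  Matrix.GeneralLinearGroup.mkOfDetNeZero (Matrix.diagonal fun i => (z i : ℂ)) (by
    rw [Matrix.det_diagonal]
    exact Finset.prod_ne_zero_iff.mpr fun i _ => (z i).ne_zero)

section Representations

variable {n : ℕ} {V : Type*} [AddCommGroup V] [Module ℂ V]

/-- A representation of `GL_n(ℂ)` is rational if each matrix coefficient is a polynomial in the
entries of the matrix divided by a power of its determinant. -/
def IsRational (ρ : Representation ℂ (Matrix.GeneralLinearGroup (Fin n) ℂ) V) : Prop :=
  ∀ (f : Module.Dual ℂ V) (v : V), ∃ (Q : MvPolynomial (Fin n × Fin n) ℂ) (N : ℕ),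
    ∀ g : Matrix.GeneralLinearGroup (Fin n) ℂ,
      f (ρ g v) = MvPolynomial.eval (fun ij => (g : Matrix (Fin n) (Fin n) ℂ) ij.1 ij.2) Q /
        (g : Matrix (Fin n) (Fin n) ℂ).det ^ N

/-- There is a highest weight vector of weight `w`: a nonzero vector on which every invertible
upper triangular matrix `b` acts by the scalar `∏ i, (b i i) ^ (w i)`. -/
def HasHighestWeight (ρ : Representation ℂ (Matrix.GeneralLinearGroup (Fin n) ℂ) V)
    (w : Fin n → ℤ) : Prop :=
  ∃ v : V, v ≠ 0 ∧ ∀ b : Matrix.GeneralLinearGroup (Fin n) ℂ,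
    (∀ i j, j < i → (b : Matrix (Fin n) (Fin n) ℂ) i j = 0) →
      ρ b v = (∏ i, (b : Matrix (Fin n) (Fin n) ℂ) i i ^ w i) • v

/-- An irreducible finite-dimensional rational representation of `GL_n(ℂ)` of highest
weight `w`. -/
structure IsIrrepOfHighestWeight
    (ρ : Representation ℂ (Matrix.GeneralLinearGroup (Fin n) ℂ) V) (w : Fin n → ℤ) : Prop where
  finite : FiniteDimensional ℂ V
  rational : IsRational ρ
  irreducible : ρ.IsIrreducible
  highestWeight : HasHighestWeight ρ w

end Representations

end QWhittaker

/-!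
Every ratio of `q`-factorials tends to `1` as `q → 0`, which gives the limit termwise.

Summing a pattern over its second row first, induction on the number of rows and multilinearity of
the determinant show that `χ_p` times the Vandermonde determinant is the alternant
`det (z_i ^ (p_j + j - 1))`. The Pieri rule follows, since an alternant times `e_r` is the sum of
the alternants with shifted exponents, and those with two equal exponents vanish.

For the character of an irreducible representation, restrict to the torus and pass to the Lie
algebra. The quadratic Casimir element acts on the highest weight representation by a scalar; taking
traces against the torus, this says that the character times the Vandermonde determinant is an
eigenfunction of the Laplace operator. It is alternating and its exponents are dominated by the
highest one, and such an eigenfunction is determined by its leading coefficient, so it is the same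
alternant. For existence, the right translates of a product of powers of leading minors (with a
power of the determinant) span a finite-dimensional rational representation generated by a highest
weight vector, and any irreducible quotient of it has the same highest weight.
-/

namespace QWhittaker

/-! ### Characters of the torus and Laurent polynomials -/

section Torus

variable {ι K : Type*} [Fintype ι] [Field K]

/-- The character `z ↦ ∏ i, z i ^ μ i` of the torus `(Kˣ)^ι`. -/
def torusChar (μ : ι → ℤ) : (ι → Kˣ) →* K where
  toFun z := ∏ i, (z i : K) ^ μ i
  map_one' := by simp
  map_mul' z y := by simp [mul_zpow, Finset.prod_mul_distrib]

theorem torusChar_apply (μ : ι → ℤ) (z : ι → Kˣ) : torusChar μ z = ∏ i, (z i : K) ^ μ i := rfl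

theorem torusChar_zero (z : ι → Kˣ) : torusChar 0 z = 1 := by
  simp [torusChar_apply]

theorem torusChar_add (μ ν : ι → ℤ) (z : ι → Kˣ) :
    torusChar (μ + ν) z = torusChar μ z * torusChar ν z := by
  simp [torusChar_apply, zpow_add₀, Finset.prod_mul_distrib]

theorem torusChar_comp (σ : Equiv.Perm ι) (μ : ι → ℤ) (z : ι → Kˣ) :
    torusChar (μ ∘ σ) (z ∘ σ) = torusChar μ z :=
  Equiv.prod_comp σ fun i => (z i : K) ^ μ i

theorem torusChar_comp_right (σ : Equiv.Perm ι) (μ : ι → ℤ) (z : ι → Kˣ) :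
    torusChar μ (z ∘ σ) = torusChar (μ ∘ σ.symm) z := by
  conv_lhs => rw [← Function.comp_id μ, ← σ.symm_comp_self, ← Function.comp_assoc, torusChar_comp]

section DecidableEq

variable [DecidableEq ι]

theorem torusChar_single (i : ι) (m : ℤ) (z : ι → Kˣ) :
    torusChar (Pi.single i m) z = (z i : K) ^ m := by
  rw [torusChar_apply, Fintype.prod_eq_single i fun j hj => by simp [Pi.single_eq_of_ne hj],
    Pi.single_eq_same]

theorem torusChar_mulSingle (μ : ι → ℤ) (i : ι) (u : Kˣ) :
    torusChar μ (Pi.mulSingle i u) = (u : K) ^ μ i := by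
  rw [torusChar_apply, Fintype.prod_eq_single i fun j hj => by simp [Pi.mulSingle_eq_of_ne hj],
    Pi.mulSingle_eq_same]

end DecidableEq

section CharZero

variable [CharZero K]

theorem zpow_two_injective : Function.Injective fun m : ℤ => (2 : K) ^ m := by
  intro a b hab
  have hrat : (2 : ℚ) ^ a = 2 ^ b := Rat.cast_injective (α := K) (by simpa using hab)
  exact zpow_right_injective₀ two_pos (by norm_num) hrat

theorem torusChar_injective :
    Function.Injective (torusChar : (ι → ℤ) → (ι → Kˣ) →* K) := by
  classical
  intro μ ν h
  funext i
  have hi := DFunLike.congr_fun h (Pi.mulSingle i (Units.mk0 2 two_ne_zero))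
  rw [torusChar_mulSingle, torusChar_mulSingle] at hi
  exact zpow_two_injective hi

theorem linearIndependent_torusChar :
    LinearIndependent K fun μ : ι → ℤ => (torusChar μ : (ι → Kˣ) → K) :=
  (linearIndependent_monoidHom (ι → Kˣ) K).comp _ torusChar_injective

theorem eq_zero_of_forall_sum_torusChar_smul {W : Type*} [AddCommGroup W] [Module K W]
    {P : (ι → ℤ) →₀ W} (h : ∀ z : ι → Kˣ, (P.sum fun μ w => torusChar μ z • w) = 0) : P = 0 := by
  ext μ
  rw [Finsupp.zero_apply, ← Module.forall_dual_apply_eq_zero_iff K]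
  intro f
  have hf : ∑ ν ∈ P.support, f (P ν) • (torusChar ν : (ι → Kˣ) → K) = 0 := by
    funext z
    have hz := congrArg f (h z)
    rw [map_finsuppSum, map_zero] at hz
    simpa [Finsupp.sum, Finset.sum_apply, mul_comm] using hz
  by_cases hμ : μ ∈ P.support
  · exact linearIndependent_iff'.mp (linearIndependent_torusChar (ι := ι) (K := K)) P.support
      (fun ν => f (P ν)) hf μ hμ
  · rw [Finsupp.notMem_support_iff.mp hμ, map_zero]

theorem finsupp_ext_of_torusChar {W : Type*} [AddCommGroup W] [Module K W] {P Q : (ι → ℤ) →₀ W}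
    (h : ∀ z : ι → Kˣ, (P.sum fun μ w => torusChar μ z • w) =
      Q.sum fun μ w => torusChar μ z • w) : P = Q := by
  rw [← sub_eq_zero]
  refine eq_zero_of_forall_sum_torusChar_smul (K := K) fun z => ?_
  rw [Finsupp.sum_sub_index fun _ _ _ => smul_sub _ _ _, h z, sub_self]

end CharZero

end Torus

section Laurent

/-- Laurent polynomials over `K` in variables indexed by `ι`. -/
abbrev Laurent (ι K : Type*) [Semiring K] := AddMonoidAlgebra K (ι → ℤ)

section Permutations

variable {ι K : Type*} [CommSemiring K]

/-- The automorphism of the algebra of Laurent polynomials renaming the variables along `σ`. -/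
noncomputable def permVars (σ : Equiv.Perm ι) : Laurent ι K ≃ₐ[K] Laurent ι K :=
  AddMonoidAlgebra.domCongr K K (LinearEquiv.funCongrLeft ℤ ℤ σ.symm).toAddEquiv

theorem permVars_single (σ : Equiv.Perm ι) (μ : ι → ℤ) (c : K) :
    permVars σ (AddMonoidAlgebra.single μ c) = AddMonoidAlgebra.single (μ ∘ σ.symm) c :=
  AddMonoidAlgebra.domCongr_single _ _ _

theorem coeff_permVars (σ : Equiv.Perm ι) (f : Laurent ι K) (μ : ι → ℤ) :
    (permVars σ f).coeff μ = f.coeff (μ ∘ σ) :=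
  AddMonoidAlgebra.coeff_domCongr _ _ _

end Permutations

variable {ι K : Type*} [Fintype ι] [Field K]

/-- Evaluation of Laurent polynomials at a point of the torus. -/
noncomputable def torusEval (z : ι → Kˣ) : Laurent ι K →ₐ[K] K :=
  AddMonoidAlgebra.lift K K (ι → ℤ)
    { toFun := fun μ => torusChar μ.toAdd z
      map_one' := torusChar_zero z
      map_mul' := fun _ _ => torusChar_add _ _ z }

theorem torusEval_single (z : ι → Kˣ) (μ : ι → ℤ) (c : K) :
    torusEval z (AddMonoidAlgebra.single μ c) = c * torusChar μ z := by
  simp [torusEval, AddMonoidAlgebra.lift_single]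

theorem torusEval_eq_sum (z : ι → Kˣ) (f : Laurent ι K) :
    torusEval z f = f.coeff.sum fun μ c => torusChar μ z • c := by
  conv_lhs => rw [← AddMonoidAlgebra.sum_coeff_single f]
  rw [map_finsuppSum]
  simp only [torusEval_single, smul_eq_mul, mul_comm]

theorem torusEval_ext [CharZero K] {f g : Laurent ι K} (h : ∀ z, torusEval z f = torusEval z g) :
    f = g :=
  AddMonoidAlgebra.coeff_injective
    (finsupp_ext_of_torusChar fun z => by rw [← torusEval_eq_sum, ← torusEval_eq_sum, h z])

theorem torusEval_permVars (σ : Equiv.Perm ι) (z : ι → Kˣ) (f : Laurent ι K) :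
    torusEval z (permVars σ f) = torusEval (z ∘ σ) f := by
  induction f using AddMonoidAlgebra.induction_linear with
  | zero => simp only [map_zero]
  | add f g hf hg => simp only [map_add, hf, hg]
  | single μ c => rw [permVars_single, torusEval_single, torusEval_single, torusChar_comp_right]

end Laurent

/-! ### The Laplace operator and alternants -/

section Derivations

theorem derivation_prod {R A M κ : Type*} [CommSemiring R] [CommSemiring A] [AddCommMonoid M]
    [Algebra R A] [Module A M] [Module R M] [DecidableEq κ] (D : Derivation R A M) (s : Finset κ)
    (f : κ → A) : D (∏ a ∈ s, f a) = ∑ a ∈ s, (∏ b ∈ s.erase a, f b) • D (f a) := by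
  induction s using Finset.induction_on with
  | empty => simp
  | insert a s ha ih =>
    rw [Finset.prod_insert ha, D.leibniz, Finset.sum_insert ha, Finset.erase_insert ha, ih,
      Finset.smul_sum, add_comm]
    congr 1
    refine Finset.sum_congr rfl fun b hb => ?_
    rw [Finset.erase_insert_of_ne (ne_of_mem_of_not_mem hb ha).symm,
      Finset.prod_insert fun h => ha (Finset.mem_of_mem_erase h), mul_smul]

variable {ι K : Type*} [CommRing K]

/-- The Euler derivation `z i ∂/∂(z i)` of the algebra of Laurent polynomials. -/
noncomputable def eulerDeriv (i : ι) : Derivation K (Laurent ι K) (Laurent ι K) :=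
  let D : Laurent ι K →ₗ[K] Laurent ι K :=
    { toFun := fun f => AddMonoidAlgebra.ofCoeff (Finsupp.onFinset f.coeff.support
        (fun μ => (μ i : K) * f.coeff μ) fun _ h =>
          Finsupp.mem_support_iff.mpr (right_ne_zero_of_mul h))
      map_add' := fun f g => by ext μ; simp [mul_add]
      map_smul' := fun c f => by ext μ; simp [mul_left_comm] }
  have D_single : ∀ μ c, D (AddMonoidAlgebra.single μ c) = AddMonoidAlgebra.single μ (μ i * c) := by
    intro μ c
    ext ν
    by_cases h : μ = ν <;> simp [D, h]
  Derivation.mk' D fun f g => by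
    induction f using AddMonoidAlgebra.induction_linear with
    | zero => simp
    | add f₁ f₂ h₁ h₂ => simp only [add_mul, map_add, h₁, h₂, smul_eq_mul]; ring
    | single μ c =>
      induction g using AddMonoidAlgebra.induction_linear with
      | zero => simp
      | add g₁ g₂ h₁ h₂ => simp only [mul_add, map_add, h₁, h₂, smul_eq_mul]; ring
      | single ν d =>
        simp only [smul_eq_mul, AddMonoidAlgebra.single_mul_single, D_single, add_comm ν μ,
          ← AddMonoidAlgebra.single_add]
        congr 1
        push_cast [Pi.add_apply]
        ring

theorem coeff_eulerDeriv (i : ι) (f : Laurent ι K) (μ : ι → ℤ) :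
    (eulerDeriv i f).coeff μ = μ i * f.coeff μ := rfl

theorem eulerDeriv_single (i : ι) (μ : ι → ℤ) (c : K) :
    eulerDeriv i (AddMonoidAlgebra.single μ c) = (μ i : K) • AddMonoidAlgebra.single μ c := by
  ext ν
  by_cases h : μ = ν <;> simp [coeff_eulerDeriv, h]

variable [Fintype ι]

/-- The Laplace operator `∑ i, (z i ∂/∂(z i)) ^ 2` on Laurent polynomials. -/
noncomputable def laplacian : Laurent ι K →ₗ[K] Laurent ι K :=
  ∑ i, (eulerDeriv i).toLinearMap ∘ₗ (eulerDeriv i).toLinearMap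

theorem laplacian_apply (f : Laurent ι K) : laplacian f = ∑ i, eulerDeriv i (eulerDeriv i f) := by
  simp [laplacian]

theorem coeff_laplacian (f : Laurent ι K) (μ : ι → ℤ) :
    (laplacian f).coeff μ = (μ ⬝ᵥ μ : ℤ) * f.coeff μ := by
  simp only [laplacian_apply, AddMonoidAlgebra.coeff_sum, Finset.sum_apply', coeff_eulerDeriv,
    dotProduct, Int.cast_sum, Int.cast_mul, Finset.sum_mul, mul_assoc]

theorem laplacian_mul (f g : Laurent ι K) :
    laplacian (f * g) =
      laplacian f * g + 2 * ∑ i, eulerDeriv i f * eulerDeriv i g + f * laplacian g := by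
  simp only [laplacian_apply, Derivation.leibniz, map_add, smul_eq_mul, Finset.sum_mul,
    Finset.mul_sum, ← Finset.sum_add_distrib]
  exact Finset.sum_congr rfl fun i _ => by ring

end Derivations

section Alternating

variable {ι K : Type*} [Fintype ι] [DecidableEq ι] [CommRing K]

/-- A Laurent polynomial is alternating if a permutation of the variables multiplies it by the
sign of the permutation. -/
def IsAlternating (f : Laurent ι K) : Prop :=
  ∀ σ : Equiv.Perm ι, permVars σ f = ((Equiv.Perm.sign σ : ℤ) : K) • f

theorem IsAlternating.sub {f g : Laurent ι K} (hf : IsAlternating f) (hg : IsAlternating g) :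
    IsAlternating (f - g) := fun σ => by rw [map_sub, hf, hg, smul_sub]

theorem IsAlternating.mul_of_symmetric {f g : Laurent ι K} (hf : IsAlternating f)
    (hg : ∀ σ, permVars σ g = g) : IsAlternating (f * g) := fun σ => by
  rw [map_mul, hf, hg, smul_mul_assoc]

theorem IsAlternating.coeff_comp {f : Laurent ι K} (hf : IsAlternating f) (σ : Equiv.Perm ι)
    (μ : ι → ℤ) : f.coeff (μ ∘ σ) = ((Equiv.Perm.sign σ : ℤ) : K) * f.coeff μ := by
  rw [← coeff_permVars, hf]
  rfl

theorem IsAlternating.eq_zero_of_antitone {n : ℕ} {f : Laurent (Fin n) K} (hf : IsAlternating f)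
    (h : ∀ μ, Antitone μ → f.coeff μ = 0) : f = 0 := by
  ext μ
  have hanti : Antitone (μ ∘ (Tuple.sort μ * Fin.revPerm : Equiv.Perm (Fin n))) :=
    fun _ _ hij => Tuple.monotone_sort μ (Fin.rev_le_rev.mpr hij)
  have hsign : IsUnit ((Equiv.Perm.sign (Tuple.sort μ * Fin.revPerm) : ℤ) : K) :=
    (Units.isUnit _).map (Int.castRingHom K)
  exact hsign.mul_right_eq_zero.mp ((hf.coeff_comp _ μ).symm.trans (h _ hanti))

/-- The alternant `det (z i ^ ν j)`. -/
noncomputable def alternant (ν : ι → ℤ) : Laurent ι K :=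
  (Matrix.of fun i j => AddMonoidAlgebra.single (Pi.single i (ν j)) (1 : K)).det

theorem isAlternating_alternant (ν : ι → ℤ) : IsAlternating (alternant ν : Laurent ι K) := by
  intro σ
  rw [alternant, AlgEquiv.map_det, Int.cast_smul_eq_zsmul, zsmul_eq_mul, ← Matrix.det_permute]
  congr 1
  ext1 i j
  rw [AlgEquiv.mapMatrix_apply, Matrix.map_apply, Matrix.of_apply, permVars_single,
    Pi.single_comp_equiv, Equiv.symm_symm]
  rfl

theorem alternant_eq_zero {ν : ι → ℤ} {i j : ι} (hij : i ≠ j) (h : ν i = ν j) :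
    (alternant ν : Laurent ι K) = 0 :=
  Matrix.det_zero_of_column_eq hij fun k => by simp only [Matrix.of_apply, h]

theorem alternant_eq_sum (ν : ι → ℤ) :
    (alternant ν : Laurent ι K) = ∑ σ : Equiv.Perm ι, ((Equiv.Perm.sign σ : ℤ) : K) •
      AddMonoidAlgebra.single (ν ∘ σ) 1 := by
  rw [alternant, ← Matrix.det_transpose, Matrix.det_apply']
  refine Finset.sum_congr rfl fun σ _ => ?_
  simp only [Matrix.transpose_apply, Matrix.of_apply, AddMonoidAlgebra.prod_single,
    Finset.prod_const_one, Int.cast_smul_eq_zsmul, zsmul_eq_mul]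
  rw [← Finset.univ_sum_single (ν ∘ σ)]
  rfl

theorem exists_eq_comp_of_coeff_alternant_ne_zero {ν μ : ι → ℤ}
    (h : (alternant ν : Laurent ι K).coeff μ ≠ 0) : ∃ σ : Equiv.Perm ι, μ = ν ∘ σ := by
  by_contra! hne
  refine h ?_
  rw [alternant_eq_sum, AddMonoidAlgebra.coeff_sum, Finset.sum_apply']
  exact Finset.sum_eq_zero fun σ _ => by simp [(hne σ).symm]

theorem coeff_alternant_comp {ν : ι → ℤ} (hν : Function.Injective ν) (τ : Equiv.Perm ι) :
    (alternant ν : Laurent ι K).coeff (ν ∘ τ) = ((Equiv.Perm.sign τ : ℤ) : K) := by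
  rw [alternant_eq_sum, AddMonoidAlgebra.coeff_sum, Finset.sum_apply',
    Fintype.sum_eq_single τ fun σ hσ => ?_]
  · simp
  · simp [hν.comp_left.ne (DFunLike.coe_injective.ne hσ)]

theorem laplacian_alternant (ν : ι → ℤ) :
    laplacian (alternant ν : Laurent ι K) = ((ν ⬝ᵥ ν : ℤ) : K) • alternant ν := by
  ext μ
  rw [coeff_laplacian, AddMonoidAlgebra.coeff_smul_apply, smul_eq_mul]
  by_cases h : (alternant ν : Laurent ι K).coeff μ = 0
  · rw [h, mul_zero, mul_zero]
  · obtain ⟨σ, rfl⟩ := exists_eq_comp_of_coeff_alternant_ne_zero h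
    rw [comp_equiv_dotProduct_comp_equiv]

end Alternating

section Vandermonde

variable {ι K : Type*} [DecidableEq ι] [CommRing K]

/-- The variable `z i` as a Laurent polynomial. -/
noncomputable def laurentVar (i : ι) : Laurent ι K := AddMonoidAlgebra.single (Pi.single i 1) 1

theorem laurentVar_injective [Nontrivial K] :
    Function.Injective (laurentVar : ι → Laurent ι K) := fun i j hij => by
  have hsingle : (Pi.single i 1 : ι → ℤ) = Pi.single j 1 :=
    (AddMonoidAlgebra.single_left_inj one_ne_zero).mp hij
  by_contra hne
  simpa [hne] using congrFun hsingle i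

theorem coeff_laurentVar_mul (i : ι) (f : Laurent ι K) (μ : ι → ℤ) :
    (laurentVar i * f).coeff μ = f.coeff (μ - Pi.single i 1) := by
  rw [laurentVar, AddMonoidAlgebra.coeff_single_mul_eq_mul_coeff (μ - Pi.single i 1)
    fun ν _ => (eq_sub_iff_add_eq' (b := μ)).symm, one_mul]

theorem laurentVar_pow (i : ι) (m : ℕ) :
    (laurentVar i : Laurent ι K) ^ m = AddMonoidAlgebra.single (Pi.single i (m : ℤ)) 1 := by
  rw [laurentVar, AddMonoidAlgebra.single_pow, one_pow, ← Pi.single_smul, nsmul_one]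

theorem eulerDeriv_laurentVar (i j : ι) :
    eulerDeriv i (laurentVar j : Laurent ι K) = if i = j then laurentVar j else 0 := by
  rw [laurentVar, eulerDeriv_single, Pi.single_apply]
  split_ifs <;> simp

/-- The exponents `0, 1, …, n - 1` of the Vandermonde determinant. -/
def delta (n : ℕ) : Fin n → ℤ := fun j => (j : ℤ)

theorem delta_strictMono (n : ℕ) : StrictMono (delta n) := fun _ _ h => Int.ofNat_lt.mpr h

variable {n : ℕ}

theorem alternant_delta_eq_prod :
    (alternant (delta n) : Laurent (Fin n) K) =
      ∏ i, ∏ j ∈ Finset.Ioi i, (laurentVar j - laurentVar i) := by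
  rw [← Matrix.det_vandermonde, alternant]
  congr 1
  ext1 i j
  rw [Matrix.of_apply, Matrix.vandermonde_apply, laurentVar_pow, delta]

theorem alternant_delta_ne_zero [IsDomain K] :
    (alternant (delta n) : Laurent (Fin n) K) ≠ 0 := by
  rw [alternant_delta_eq_prod, Finset.prod_ne_zero_iff]
  exact fun i _ => Finset.prod_ne_zero_iff.mpr fun j hj =>
    sub_ne_zero.mpr (laurentVar_injective.ne (Finset.mem_Ioi.mp hj).ne')

theorem sum_eulerDeriv_sub_mul [Fintype ι] (i j : ι) (f : Laurent ι K) :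
    ∑ k, eulerDeriv k (laurentVar j - laurentVar i) * eulerDeriv k f =
      laurentVar j * eulerDeriv j f - laurentVar i * eulerDeriv i f := by
  simp [eulerDeriv_laurentVar, sub_mul, Finset.sum_sub_distrib, ite_mul]

/- The logarithmic derivative of the Vandermonde product turns division by `z j - z i` into the
hypothesis on `T`. -/
theorem two_mul_sum_eulerDeriv_alternant_delta (f : Laurent (Fin n) K)
    (T : Fin n → Fin n → Laurent (Fin n) K)
    (hT : ∀ i j, i < j → (laurentVar j - laurentVar i) * T i j =
      (laurentVar i + laurentVar j) * (eulerDeriv j f - eulerDeriv i f)) :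
    2 * ∑ k, eulerDeriv k (alternant (delta n)) * eulerDeriv k f =
      alternant (delta n) *
        ∑ i, ∑ j ∈ Finset.Ioi i, (T i j + (eulerDeriv i f + eulerDeriv j f)) := by
  classical
  rw [alternant_delta_eq_prod, Finset.prod_sigma', Finset.sum_sigma']
  set s := (Finset.univ : Finset (Fin n)).sigma fun i => Finset.Ioi i
  simp only [derivation_prod, Finset.sum_mul]
  rw [Finset.sum_comm, Finset.mul_sum, Finset.mul_sum]
  refine Finset.sum_congr rfl fun ⟨i, j⟩ hs => ?_
  have hij : i < j := Finset.mem_Ioi.mp (Finset.mem_sigma.mp hs).2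
  simp only [smul_eq_mul, mul_assoc, ← Finset.mul_sum]
  rw [sum_eulerDeriv_sub_mul, ← Finset.mul_prod_erase s _ hs]
  linear_combination (-∏ b ∈ s.erase ⟨i, j⟩, (laurentVar b.2 - laurentVar b.1)) * hT i j hij

end Vandermonde

section Dominance

theorem antitone_indicator_one {ι : Type*} [Preorder ι] {s : Set ι} (hs : IsLowerSet s) :
    Antitone (s.indicator (1 : ι → ℤ)) := fun j k hjk => by
  by_cases hk : k ∈ s
  · simp [hk, hs hjk hk]
  · simpa only [Set.indicator_of_notMem hk] using
      Set.indicator_apply_nonneg fun _ : j ∈ s => zero_le_one' ℤ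

variable {ι : Type*} [Fintype ι]

/-- The dominance order on weights: `μ` is dominated by `w` if its pairing with every decreasing
sequence is at most that of `w`. Pairing with the indicators of initial segments gives the usual
comparison of partial sums, and pairing with `±1` the equality of the total sums. -/
def DominatedBy [Preorder ι] (μ w : ι → ℤ) : Prop :=
  ∀ c : ι → ℤ, Antitone c → c ⬝ᵥ μ ≤ c ⬝ᵥ w

section Preorder

variable [Preorder ι] {μ ν w y : ι → ℤ}

theorem DominatedBy.refl (μ : ι → ℤ) : DominatedBy μ μ := fun _ _ => le_rfl

theorem DominatedBy.add (h : DominatedBy μ w) (h' : DominatedBy ν y) :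
    DominatedBy (μ + ν) (w + y) := fun c hc => by
  simpa only [dotProduct_add] using add_le_add (h c hc) (h' c hc)

theorem DominatedBy.add_single_sub_single [DecidableEq ι] (h : DominatedBy μ w) {i j : ι}
    (hij : i ≤ j) : DominatedBy (μ + (Pi.single j 1 - Pi.single i 1)) w := fun c hc => by
  have hpair := h c hc
  have hc' := hc hij
  simp only [dotProduct_add, dotProduct_sub, dotProduct_single_one]
  linarith

theorem DominatedBy.sum_eq (h : DominatedBy μ w) : ∑ i, μ i = ∑ i, w i := by
  have hle := h 1 antitone_const
  have hge := h (-1) antitone_const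
  simp only [neg_dotProduct, one_dotProduct] at hle hge
  linarith

end Preorder

theorem DominatedBy.antisymm [PartialOrder ι] {μ ν : ι → ℤ} (h : DominatedBy μ ν)
    (h' : DominatedBy ν μ) : μ = ν := by
  classical
  funext i
  have hpair {s : Set ι} (hs : IsLowerSet s) : s.indicator 1 ⬝ᵥ μ = s.indicator 1 ⬝ᵥ ν :=
    le_antisymm (h _ (antitone_indicator_one hs)) (h' _ (antitone_indicator_one hs))
  have hsingle : (Pi.single i 1 : ι → ℤ) =
      (Set.Iic i).indicator 1 - (Set.Iio i).indicator 1 := by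
    rw [← Set.Iic_sdiff_right, Set.indicator_sdiff (s := {i}) (t := Set.Iic i) (by simp),
      sub_sub_cancel]
    exact (Set.indicator_singleton i 1).symm
  calc μ i = Pi.single i 1 ⬝ᵥ μ := (single_one_dotProduct i μ).symm
    _ = Pi.single i 1 ⬝ᵥ ν := by
      rw [hsingle, sub_dotProduct, sub_dotProduct, hpair (isLowerSet_Iic i),
        hpair (isLowerSet_Iio i)]
    _ = ν i := single_one_dotProduct i ν

theorem DominatedBy.eq_of_add_eq [PartialOrder ι] {α β μ ν : ι → ℤ} (hα : DominatedBy α μ)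
    (hβ : DominatedBy β ν) (h : α + β = μ + ν) : α = μ := by
  refine hα.antisymm fun c hc => ?_
  have hsum := congrArg (c ⬝ᵥ ·) h
  simp only [dotProduct_add] at hsum
  linarith [hβ c hc]

theorem dominatedBy_comp_perm [LinearOrder ι] {w : ι → ℤ} (hw : Antitone w) (σ : Equiv.Perm ι) :
    DominatedBy (w ∘ σ) w := fun _ hc => (hc.monovary hw).sum_mul_comp_perm_le_sum_mul

theorem DominatedBy.eq_of_dotProduct_self_eq [Preorder ι] {μ ν : ι → ℤ} (h : DominatedBy μ ν)
    (hμ : Antitone μ) (hsq : μ ⬝ᵥ μ = ν ⬝ᵥ ν) : μ = ν := by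
  have hle : (ν - μ) ⬝ᵥ (ν - μ) ≤ 0 := by
    simp only [sub_dotProduct, dotProduct_sub, dotProduct_comm ν μ]
    linarith [h μ hμ]
  have hzero := le_antisymm hle (Finset.sum_nonneg fun i _ => mul_self_nonneg ((ν - μ) i))
  exact (sub_eq_zero.mp (dotProduct_self_eq_zero.mp hzero)).symm

variable {K : Type*} [CommRing K]

theorem coeff_mul_of_dominatedBy [PartialOrder ι] {f g : Laurent ι K} {μ ν : ι → ℤ}
    (hf : ∀ α, f.coeff α ≠ 0 → DominatedBy α μ) (hg : ∀ β, g.coeff β ≠ 0 → DominatedBy β ν) :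
    (f * g).coeff (μ + ν) = f.coeff μ * g.coeff ν := by
  refine AddMonoidAlgebra.coeff_mul_add_of_uniqueAdd fun α β hα hβ h => ?_
  have hα' := hf α (Finsupp.mem_support_iff.mp hα)
  have hαμ := hα'.eq_of_add_eq (hg β (Finsupp.mem_support_iff.mp hβ)) h
  exact ⟨hαμ, add_left_cancel (hαμ ▸ h)⟩

theorem dominatedBy_of_coeff_mul_ne_zero [Preorder ι] {f g : Laurent ι K} {μ ν : ι → ℤ}
    (hf : ∀ α, f.coeff α ≠ 0 → DominatedBy α μ) (hg : ∀ β, g.coeff β ≠ 0 → DominatedBy β ν)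
    {w : ι → ℤ} (h : (f * g).coeff w ≠ 0) : DominatedBy w (μ + ν) := by
  classical
  obtain ⟨α, hα, β, hβ, rfl⟩ := Finset.mem_add.mp
    (AddMonoidAlgebra.support_coeff_mul_subset _ _ (Finsupp.mem_support_iff.mpr h))
  exact (hf α (Finsupp.mem_support_iff.mp hα)).add (hg β (Finsupp.mem_support_iff.mp hβ))

theorem dominatedBy_rev_of_coeff_alternant_ne_zero {n : ℕ} {ν μ : Fin n → ℤ} (hν : Monotone ν)
    (h : (alternant ν : Laurent (Fin n) K).coeff μ ≠ 0) : DominatedBy μ (ν ∘ Fin.rev) := by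
  obtain ⟨σ, rfl⟩ := exists_eq_comp_of_coeff_alternant_ne_zero h
  have hrev : Antitone (ν ∘ Fin.rev) := fun _ _ hij => hν (Fin.rev_le_rev.mpr hij)
  simpa [Function.comp_def] using dominatedBy_comp_perm hrev (σ.trans Fin.revPerm)

theorem coeff_alternant_rev {n : ℕ} {ν : Fin n → ℤ} (hν : Function.Injective ν) :
    (alternant ν : Laurent (Fin n) K).coeff (ν ∘ Fin.rev) =
      ((Equiv.Perm.sign (Fin.revPerm : Equiv.Perm (Fin n)) : ℤ) : K) :=
  coeff_alternant_comp hν Fin.revPerm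

end Dominance

section EigenfunctionUniqueness

variable {n : ℕ} {K : Type*} [Field K] [CharZero K]

/- By antisymmetry only decreasing weights matter, and among those dominated by `w` no other
one has the same length as `w`. -/
theorem IsAlternating.eq_zero_of_laplacian_eq {f : Laurent (Fin n) K} (hf : IsAlternating f)
    {w : Fin n → ℤ} (hlap : laplacian f = ((w ⬝ᵥ w : ℤ) : K) • f)
    (hdom : ∀ μ, f.coeff μ ≠ 0 → DominatedBy μ w) (hw : f.coeff w = 0) : f = 0 := by
  refine hf.eq_zero_of_antitone fun μ hμ => ?_
  by_contra hne
  have heq : ((μ ⬝ᵥ μ : ℤ) : K) * f.coeff μ = ((w ⬝ᵥ w : ℤ) : K) * f.coeff μ := by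
    rw [← coeff_laplacian, hlap]
    rfl
  have hlen : μ ⬝ᵥ μ = w ⬝ᵥ w := Int.cast_injective (mul_right_cancel₀ hne heq)
  exact hne ((hdom μ hne).eq_of_dotProduct_self_eq hμ hlen ▸ hw)

theorem IsAlternating.eq_alternant {f : Laurent (Fin n) K} (hf : IsAlternating f)
    {ν : Fin n → ℤ} (hν : StrictMono ν) {κ : K} (hlap : laplacian f = κ • f)
    (hdom : ∀ μ, f.coeff μ ≠ 0 → DominatedBy μ (ν ∘ Fin.rev))
    (hlead : f.coeff (ν ∘ Fin.rev) = (alternant ν : Laurent (Fin n) K).coeff (ν ∘ Fin.rev)) :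
    f = alternant ν := by
  set w := ν ∘ Fin.rev
  have hne : f.coeff w ≠ 0 := by
    rw [hlead, coeff_alternant_rev hν.injective]
    exact_mod_cast (Equiv.Perm.sign _).ne_zero
  have hκ : ((w ⬝ᵥ w : ℤ) : K) = κ := mul_right_cancel₀ hne <| by
    rw [← coeff_laplacian, hlap]
    rfl
  have hlen : w ⬝ᵥ w = ν ⬝ᵥ ν := comp_equiv_dotProduct_comp_equiv ν ν Fin.revPerm
  rw [← sub_eq_zero]
  refine (hf.sub (isAlternating_alternant ν)).eq_zero_of_laplacian_eq (w := w) ?_ ?_ ?_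
  · rw [map_sub, hlap, laplacian_alternant, ← hlen, hκ, smul_sub]
  · intro μ hμ
    by_cases h0 : f.coeff μ = 0
    · refine dominatedBy_rev_of_coeff_alternant_ne_zero hν.monotone (K := K) fun h => hμ ?_
      rw [AddMonoidAlgebra.coeff_sub, Finsupp.sub_apply, h0, h, sub_zero]
    · exact hdom μ h0
  · rw [AddMonoidAlgebra.coeff_sub, Finsupp.sub_apply, hlead, sub_self]

end EigenfunctionUniqueness

/-! ### Gelfand–Zetlin sums -/

section Branching

theorem one_sub_mul_sum_zpow_Ico {K : Type*} [Field K] {u : K} (hu : u ≠ 0) {a b : ℤ}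
    (hab : a ≤ b) : (1 - u) * ∑ m ∈ Finset.Ico a b, u ^ m = u ^ a - u ^ b := by
  induction b, hab using Int.leInduction with
  | base => simp
  | succ b hb ih =>
    rw [← Finset.insert_Ico_right_eq_Ico_add_one hb, Finset.sum_insert (by simp), mul_add, ih,
      zpow_add_one₀ hu]
    ring

theorem zpow_sum {ι K : Type*} [CommGroupWithZero K] {a : K} (ha : a ≠ 0) (s : Finset ι)
    (f : ι → ℤ) : a ^ ∑ j ∈ s, f j = ∏ j ∈ s, a ^ f j := by
  induction s using Finset.cons_induction with
  | empty => simp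
  | cons b s hb ih => rw [Finset.sum_cons, Finset.prod_cons, zpow_add₀ ha, ih]

theorem det_of_sum_eq_sum_piFinset {ι R α : Type*} [Fintype ι] [DecidableEq ι] [CommRing R]
    (f : ι → α → R) (s : ι → Finset α) :
    (Matrix.of fun i j => ∑ a ∈ s j, f i a).det =
      ∑ κ ∈ Fintype.piFinset s, (Matrix.of fun i j => f i (κ j)).det := by
  rw [← Matrix.det_transpose]
  have hcols : (Matrix.of fun i j => ∑ a ∈ s j, f i a).transpose =
      fun j => ∑ a ∈ s j, fun i => f i a := by
    ext j i
    simp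
  rw [hcols]
  refine (Matrix.detRowAlternating.toMultilinearMap.map_sum_finset _ s).trans ?_
  exact Finset.sum_congr rfl fun κ _ => Matrix.det_transpose (Matrix.of fun i j => f i (κ j))

theorem det_eq_det_sub_of_last_row_eq_one {R : Type*} [CommRing R] {n : ℕ}
    (C : Matrix (Fin (n + 1)) (Fin (n + 1)) R) (hC : ∀ j, C (Fin.last n) j = 1) :
    C.det = (Matrix.of fun i j : Fin n =>
      C i.castSucc j.castSucc - C i.castSucc j.succ).det := by
  set B : Matrix (Fin (n + 1)) (Fin (n + 1)) R :=
    Matrix.of fun i => Fin.cons (C i 0) fun j => C i j.succ - C i j.castSucc with hB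
  have hminor : B.submatrix (Fin.last n).succAbove (Fin.succAbove 0) =
      -Matrix.of fun i j : Fin n => C i.castSucc j.castSucc - C i.castSucc j.succ := by
    ext i j
    simp [hB]
  rw [Matrix.det_eq_of_forall_col_eq_smul_add_pred (B := B) (fun _ => 1) (by simp [hB])
    (by simp [hB]), Matrix.det_succ_row B (Fin.last n), Fin.sum_univ_succ,
    Finset.sum_eq_zero fun j _ => by simp [hB, hC], hminor, Matrix.det_neg, Fintype.card_fin]
  simp [hB, hC, ← mul_assoc, ← mul_pow]

variable {ι K : Type*} [Fintype ι] [Field K]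

theorem torusEval_alternant [DecidableEq ι] (ν : ι → ℤ) (z : ι → Kˣ) :
    torusEval z (alternant ν) = (Matrix.of fun i j => (z i : K) ^ ν j).det := by
  rw [alternant, AlgHom.map_det]
  congr 1
  ext1 i j
  simp [torusEval_single, torusChar_single]

theorem torusEval_smul_alternant [DecidableEq ι] (ν : ι → ℤ) (y : Kˣ) (z : ι → Kˣ) :
    torusEval (y • z) (alternant ν) = (y : K) ^ (∑ i, ν i) * torusEval z (alternant ν) := by
  rw [torusEval_alternant, torusEval_alternant, zpow_sum y.ne_zero, ← Matrix.det_mul_row]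
  congr 1
  ext1 i j
  simp [mul_zpow]

variable {n : ℕ}

theorem torusEval_snoc_one_alternant {ν : Fin (n + 1) → ℤ} (hν : Monotone ν) (x : Fin n → Kˣ) :
    torusEval (Fin.snoc x 1 : Fin (n + 1) → Kˣ) (alternant ν) =
      (∏ i, (1 - (x i : K))) *
        ∑ κ ∈ Fintype.piFinset fun j : Fin n => Finset.Ico (ν j.castSucc) (ν j.succ),
          torusEval x (alternant κ) := by
  rw [torusEval_alternant, det_eq_det_sub_of_last_row_eq_one _ (by simp)]
  simp only [torusEval_alternant]
  rw [← det_of_sum_eq_sum_piFinset (fun i a => (x i : K) ^ a), ← Matrix.det_mul_column]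
  congr 1
  ext1 i j
  simp [one_sub_mul_sum_zpow_Ico (x i).ne_zero (hν (Fin.castSucc_le_succ j))]

theorem torusEval_alternant_succ {ν : Fin (n + 1) → ℤ} (hν : Monotone ν) (z : Fin (n + 1) → Kˣ) :
    torusEval z (alternant ν) =
      (∏ i : Fin n, ((z (Fin.last n) : K) - z i.castSucc)) *
        ∑ κ ∈ Fintype.piFinset fun j : Fin n => Finset.Ico (ν j.castSucc) (ν j.succ),
          torusEval (z ∘ Fin.castSucc) (alternant κ) *
            (z (Fin.last n) : K) ^ (∑ j, ν j - ∑ j, κ j - n) := by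
  set y := z (Fin.last n)
  set x := z ∘ Fin.castSucc
  have hz : z = y • Fin.snoc (y⁻¹ • x) 1 := by
    funext i
    refine Fin.lastCases ?_ (fun i => ?_) i <;> simp [x, y]
  have hfactor (i : Fin n) : 1 - ((y⁻¹ • x) i : K) = (y : K)⁻¹ * (y - x i) := by
    simp [mul_sub]
  conv_lhs => rw [hz]
  rw [torusEval_smul_alternant, torusEval_snoc_one_alternant hν]
  simp only [hfactor, Finset.prod_mul_distrib, Finset.prod_const, Finset.card_univ,
    Fintype.card_fin, torusEval_smul_alternant, Finset.mul_sum]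
  refine Finset.sum_congr rfl fun κ _ => ?_
  rw [zpow_sub₀ y.ne_zero, zpow_sub₀ y.ne_zero, Units.val_inv_eq_inv_val, inv_zpow, inv_pow,
    zpow_natCast]
  simp only [x, Function.comp_apply]
  field_simp

/-- The box of rows interlacing with the row `p`. -/
noncomputable def interlacingRows (p : Fin (n + 1) → ℤ) : Finset (Fin n → ℤ) :=
  Fintype.piFinset fun j => Finset.Icc (p j.castSucc) (p j.succ)

theorem mem_interlacingRows {p : Fin (n + 1) → ℤ} {r : Fin n → ℤ} :
    r ∈ interlacingRows p ↔ ∀ j, p j.castSucc ≤ r j ∧ r j ≤ p j.succ := by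
  simp [interlacingRows]

theorem interlacingRows_zero : interlacingRows (0 : Fin (n + 1) → ℤ) = {0} := by
  ext r
  simp only [mem_interlacingRows, Pi.zero_apply, Finset.mem_singleton, funext_iff,
    ← le_antisymm_iff, eq_comm]

theorem monotone_of_mem_interlacingRows {p : Fin (n + 1) → ℤ} {r : Fin n → ℤ}
    (h : r ∈ interlacingRows p) : Monotone r := by
  rw [mem_interlacingRows] at h
  cases n with
  | zero => exact fun i => i.elim0
  | succ n =>
    exact Fin.monotone_iff_le_succ.mpr fun i =>
      (h i.castSucc).2.trans (Fin.succ_castSucc i ▸ (h i.succ).1)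

theorem sum_piFinset_add_delta {M : Type*} [AddCommMonoid M] (p : Fin (n + 1) → ℤ)
    (F : (Fin n → ℤ) → M) :
    ∑ κ ∈ Fintype.piFinset fun j : Fin n =>
      Finset.Ico ((p + delta (n + 1)) j.castSucc) ((p + delta (n + 1)) j.succ), F κ =
      ∑ r ∈ interlacingRows p, F (r + delta n) := by
  refine (Finset.sum_nbij' (· + delta n) (· - delta n) ?_ ?_ ?_ ?_ fun _ _ => rfl).symm
  · intro r hr
    simp only [mem_interlacingRows, Fintype.mem_piFinset, Finset.mem_Ico, Pi.add_apply, delta,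
      Fin.val_castSucc, Fin.val_succ] at hr ⊢
    exact fun j => by have := hr j; omega
  · intro κ hκ
    simp only [mem_interlacingRows, Fintype.mem_piFinset, Finset.mem_Ico, Pi.add_apply,
      Pi.sub_apply, delta, Fin.val_castSucc, Fin.val_succ] at hκ ⊢
    exact fun j => by have := hκ j; omega
  · exact fun r _ => add_sub_cancel_right r _
  · exact fun κ _ => sub_add_cancel κ _

theorem strictMono_add_delta {p : Fin n → ℤ} (hp : Monotone p) : StrictMono (p + delta n) :=
  hp.add_strictMono (delta_strictMono n)

theorem torusEval_alternant_add_delta_succ {p : Fin (n + 1) → ℤ} (hp : Monotone p)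
    (z : Fin (n + 1) → Kˣ) :
    torusEval z (alternant (p + delta (n + 1))) =
      (∏ i : Fin n, ((z (Fin.last n) : K) - z i.castSucc)) *
        ∑ r ∈ interlacingRows p, torusEval (z ∘ Fin.castSucc) (alternant (r + delta n)) *
          (z (Fin.last n) : K) ^ (∑ j, p j - ∑ j, r j) := by
  rw [torusEval_alternant_succ (strictMono_add_delta hp).monotone, sum_piFinset_add_delta]
  congr 1
  refine Finset.sum_congr rfl fun r _ => ?_
  congr 2
  have hdelta : ∑ j, delta (n + 1) j = ∑ j, delta n j + n := Fin.sum_univ_castSucc _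
  simp only [Pi.add_apply, Finset.sum_add_distrib, hdelta]
  ring

theorem torusEval_alternant_delta_succ (z : Fin (n + 1) → Kˣ) :
    torusEval z (alternant (delta (n + 1))) =
      (∏ i : Fin n, ((z (Fin.last n) : K) - z i.castSucc)) *
        torusEval (z ∘ Fin.castSucc) (alternant (delta n)) := by
  simpa [interlacingRows_zero] using torusEval_alternant_add_delta_succ monotone_const z (p := 0)

end Branching

section Patterns

/-- Cut off the top row of a pattern with `ℓ + 2` rows. -/
def dropTop (ℓ : ℕ) (P : ℕ → ℕ → ℤ) : ℕ → ℕ → ℤ := fun k i => if k ≤ ℓ + 1 then P k i else 0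

/-- Put the row `p` on top of a pattern with `ℓ + 1` rows. -/
def addTop (ℓ : ℕ) (p : Fin (ℓ + 2) → ℤ) (P : ℕ → ℕ → ℤ) : ℕ → ℕ → ℤ := fun k i =>
  if k = ℓ + 2 then (if h : 1 ≤ i ∧ i ≤ ℓ + 2 then p ⟨i - 1, by omega⟩ else 0) else P k i

variable {ℓ : ℕ} {P : ℕ → ℕ → ℤ}

theorem rowSum_top {p : Fin (ℓ + 1) → ℤ} (hP : P ∈ gzPatterns ℓ p) :
    rowSum P (ℓ + 1) = ∑ j, p j := by
  rw [rowSum, ← Finset.Ico_add_one_right_eq_Icc, Finset.sum_Ico_eq_sum_range, Finset.sum_range]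
  exact Finset.sum_congr rfl fun j _ => by rw [add_comm 1, hP.1 j]

theorem rowSum_dropTop {k : ℕ} (hk : k ≤ ℓ + 1) : rowSum (dropTop ℓ P) k = rowSum P k := by
  simp [rowSum, dropTop, hk]

variable {p : Fin (ℓ + 2) → ℤ} {r : Fin (ℓ + 1) → ℤ}

theorem dropTop_mem_gzPatterns (hP : P ∈ gzPatterns (ℓ + 1) p) :
    dropTop ℓ P ∈ gzPatterns ℓ fun j => P (ℓ + 1) (j + 1) := by
  obtain ⟨-, hinterlace, hzero⟩ := hP
  refine ⟨fun i => by simp [dropTop], fun k i hi hik hk => ?_, fun k i h => ?_⟩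
  · simpa [dropTop, show k ≤ ℓ + 1 by omega, hk] using hinterlace k i hi hik (by omega)
  · by_cases hk : k ≤ ℓ + 1
    · simpa [dropTop, hk] using hzero k i (by omega)
    · simp [dropTop, hk]

theorem row_mem_interlacingRows (hP : P ∈ gzPatterns (ℓ + 1) p) :
    (fun j : Fin (ℓ + 1) => P (ℓ + 1) (j + 1)) ∈ interlacingRows p := by
  obtain ⟨htop, hinterlace, -⟩ := hP
  rw [mem_interlacingRows]
  intro j
  rw [← htop j.castSucc, ← htop j.succ]
  exact hinterlace (ℓ + 1) (j + 1) (by omega) (by omega) le_rfl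

theorem addTop_mem_gzPatterns (hr : r ∈ interlacingRows p) (hP : P ∈ gzPatterns ℓ r) :
    addTop ℓ p P ∈ gzPatterns (ℓ + 1) p := by
  obtain ⟨htop, hinterlace, hzero⟩ := hP
  rw [mem_interlacingRows] at hr
  refine ⟨fun i => ?_, fun k i hi hik hk => ?_, fun k i h => ?_⟩
  · simp [addTop, show (i : ℕ) + 1 ≤ ℓ + 2 from i.2]
  · rcases Nat.lt_or_ge k (ℓ + 1) with hlt | hge
    · simpa [addTop, show k ≠ ℓ + 2 by omega, hlt.ne] using hinterlace k i hi hik (by omega)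
    · obtain rfl : k = ℓ + 1 := by omega
      obtain ⟨j, rfl⟩ := Nat.exists_eq_add_of_le' hi
      have hj : j < ℓ + 1 := by omega
      simpa [addTop, htop ⟨j, hj⟩, hj.le, Nat.lt_succ_iff.mp hj] using hr ⟨j, hj⟩
  · by_cases hk : k = ℓ + 2
    · simp [addTop, hk, show ¬(1 ≤ i ∧ i ≤ ℓ + 2) by omega]
    · simpa [addTop, hk] using hzero k i (by omega)

theorem addTop_dropTop (hP : P ∈ gzPatterns (ℓ + 1) p) : addTop ℓ p (dropTop ℓ P) = P := by
  obtain ⟨htop, -, hzero⟩ := hP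
  funext k i
  by_cases hk : k = ℓ + 2
  · subst hk
    by_cases hi : 1 ≤ i ∧ i ≤ ℓ + 2
    · have hPi := htop ⟨i - 1, by omega⟩
      simp only [Nat.sub_add_cancel hi.1] at hPi
      simp [addTop, hi, hPi]
    · simp [addTop, hi, hzero (ℓ + 2) i (by omega)]
  · by_cases hk' : k ≤ ℓ + 1
    · simp [addTop, dropTop, hk, hk']
    · simp [addTop, dropTop, hk, hk', hzero k i (by omega)]

theorem dropTop_addTop (hP : P ∈ gzPatterns ℓ r) : dropTop ℓ (addTop ℓ p P) = P := by
  obtain ⟨-, -, hzero⟩ := hP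
  funext k i
  by_cases hk : k ≤ ℓ + 1
  · simp [addTop, dropTop, hk, show k ≠ ℓ + 2 by omega]
  · simp [dropTop, hk, hzero k i (by omega)]

theorem gzPatterns_zero (p : Fin 1 → ℤ) :
    gzPatterns 0 p = {fun k i => if k = 1 ∧ i = 1 then p 0 else 0} := by
  ext P
  rw [Set.mem_singleton_iff]
  constructor
  · rintro ⟨htop, -, hzero⟩
    funext k i
    split_ifs with h
    · rw [h.1, h.2]
      exact htop 0
    · exact hzero _ _ (by omega)
  · rintro rfl
    exact ⟨fun i => by simp [Fin.fin_one_eq_zero i], fun k i _ _ _ => by omega,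
      fun k i h => if_neg (by omega)⟩

end Patterns

section GelfandZetlinSums

/-- The Gelfand–Zetlin generating sum as a Laurent polynomial. -/
noncomputable def gzLaurent (K : Type*) [Semiring K] (ℓ : ℕ) (p : Fin (ℓ + 1) → ℤ) :
    Laurent (Fin (ℓ + 1)) K :=
  ∑ P ∈ (gzPatterns_finite ℓ p).toFinset,
    AddMonoidAlgebra.single (fun k : Fin (ℓ + 1) => rowSum P (k + 1) - rowSum P k) 1

variable {K : Type*} [Field K]

theorem torusEval_gzLaurent (ℓ : ℕ) (p : Fin (ℓ + 1) → ℤ) (z : Fin (ℓ + 1) → Kˣ) :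
    torusEval z (gzLaurent K ℓ p) = ∑ P ∈ (gzPatterns_finite ℓ p).toFinset,
      ∏ k : Fin (ℓ + 1), (z k : K) ^ (rowSum P (k + 1) - rowSum P k) := by
  simp only [gzLaurent, map_sum, torusEval_single, one_mul, torusChar_apply]

theorem gzChar_eq_torusEval {ℓ : ℕ} {p : Fin (ℓ + 1) → ℤ} (hp : Monotone p)
    (z : Fin (ℓ + 1) → ℂˣ) : gzChar ℓ p z = torusEval z (gzLaurent ℂ ℓ p) := by
  rw [torusEval_gzLaurent, gzChar, if_pos hp]

theorem torusEval_gzLaurent_zero (p : Fin 1 → ℤ) (z : Fin 1 → Kˣ) :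
    torusEval z (gzLaurent K 0 p) = (z 0 : K) ^ p 0 := by
  simp [torusEval_gzLaurent, gzPatterns_zero, rowSum]

theorem torusEval_gzLaurent_succ {ℓ : ℕ} (p : Fin (ℓ + 2) → ℤ) (z : Fin (ℓ + 2) → Kˣ) :
    torusEval z (gzLaurent K (ℓ + 1) p) = ∑ r ∈ interlacingRows p,
      torusEval (z ∘ Fin.castSucc) (gzLaurent K ℓ r) *
        (z (Fin.last (ℓ + 1)) : K) ^ (∑ j, p j - ∑ j, r j) := by
  simp only [torusEval_gzLaurent, Finset.sum_mul]
  rw [Finset.sum_sigma']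
  refine Finset.sum_bij' (fun P _ => ⟨fun j => P (ℓ + 1) (j + 1), dropTop ℓ P⟩)
    (fun x _ => addTop ℓ p x.2) ?_ ?_ ?_ ?_ ?_ <;>
    simp only [Finset.mem_sigma, Set.Finite.mem_toFinset]
  · exact fun P hP => ⟨row_mem_interlacingRows hP, dropTop_mem_gzPatterns hP⟩
  · exact fun x hx => addTop_mem_gzPatterns hx.1 hx.2
  · exact fun P hP => addTop_dropTop hP
  · rintro ⟨r, P⟩ ⟨-, hP⟩
    have hrow : (fun j : Fin (ℓ + 1) => addTop ℓ p P (ℓ + 1) (j + 1)) = r := by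
      funext j
      simpa [addTop] using hP.1 j
    simp only [hrow, dropTop_addTop hP]
  · intro P hP
    rw [Fin.prod_univ_castSucc, ← rowSum_top hP, ← rowSum_top (dropTop_mem_gzPatterns hP),
      rowSum_dropTop le_rfl]
    congr 1
    refine Finset.prod_congr rfl fun k _ => ?_
    rw [rowSum_dropTop (by omega), rowSum_dropTop (by omega)]
    rfl

theorem torusEval_alternant_delta_mul_gzLaurent {ℓ : ℕ} {p : Fin (ℓ + 1) → ℤ} (hp : Monotone p)
    (z : Fin (ℓ + 1) → Kˣ) :
    torusEval z (alternant (delta (ℓ + 1))) * torusEval z (gzLaurent K ℓ p) =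
      torusEval z (alternant (p + delta (ℓ + 1))) := by
  induction ℓ with
  | zero => simp [torusEval_gzLaurent_zero, torusEval_alternant, delta]
  | succ ℓ ih =>
    rw [torusEval_alternant_add_delta_succ hp, torusEval_gzLaurent_succ,
      torusEval_alternant_delta_succ, mul_assoc, Finset.mul_sum]
    congr 1
    refine Finset.sum_congr rfl fun r hr => ?_
    rw [← mul_assoc, ih (monotone_of_mem_interlacingRows hr)]

theorem alternant_delta_mul_gzLaurent [CharZero K] {ℓ : ℕ} {p : Fin (ℓ + 1) → ℤ}
    (hp : Monotone p) :
    alternant (delta (ℓ + 1)) * gzLaurent K ℓ p = alternant (p + delta (ℓ + 1)) :=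
  torusEval_ext fun z => by rw [map_mul, torusEval_alternant_delta_mul_gzLaurent hp]

end GelfandZetlinSums

/-! ### The limit and the Pieri rule -/

section Limit

theorem tendsto_qFactorial (n : ℤ) : Tendsto (fun q => qFactorial q n) (𝓝[>] (0 : ℝ)) (𝓝 1) := by
  have hcont : Continuous fun q => qFactorial q n := by unfold qFactorial; fun_prop
  have hzero : qFactorial 0 n = 1 := Finset.prod_eq_one fun j hj => by
    rw [zero_pow (Nat.one_le_iff_ne_zero.mp (Finset.mem_Icc.mp hj).1), sub_zero]
  exact (hzero ▸ hcont.tendsto 0).mono_left nhdsWithin_le_nhds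

theorem tendsto_qWeight (ℓ : ℕ) (P : ℕ → ℕ → ℤ) :
    Tendsto (fun q => qWeight ℓ q P) (𝓝[>] (0 : ℝ)) (𝓝 1) := by
  have hnum : Tendsto (fun q : ℝ => ∏ k ∈ Finset.Icc 2 ℓ, ∏ i ∈ Finset.Icc 1 (k - 1),
      qFactorial q (P k (i + 1) - P k i)) (𝓝[>] 0)
      (𝓝 (∏ k ∈ Finset.Icc 2 ℓ, ∏ _i ∈ Finset.Icc 1 (k - 1), 1)) :=
    tendsto_finsetProd _ fun _ _ => tendsto_finsetProd _ fun _ _ => tendsto_qFactorial _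
  have hden : Tendsto (fun q : ℝ => ∏ k ∈ Finset.Icc 1 ℓ, ∏ i ∈ Finset.Icc 1 k,
      (qFactorial q (P k i - P (k + 1) i) * qFactorial q (P (k + 1) (i + 1) - P k i)))
      (𝓝[>] 0) (𝓝 (∏ k ∈ Finset.Icc 1 ℓ, ∏ _i ∈ Finset.Icc 1 k, (1 * 1))) :=
    tendsto_finsetProd _ fun _ _ => tendsto_finsetProd _ fun _ _ =>
      (tendsto_qFactorial _).mul (tendsto_qFactorial _)
  simp only [Finset.prod_const_one, mul_one] at hnum hden
  exact div_one (1 : ℝ) ▸ hnum.div hden one_ne_zero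

theorem tendsto_qWhittakerFun {ℓ : ℕ} {p : Fin (ℓ + 1) → ℤ} (hp : Monotone p)
    {z : Fin (ℓ + 1) → ℂˣ} {lam : ℝ → Fin (ℓ + 1) → ℂ}
    (h : ∀ᶠ q : ℝ in 𝓝[>] 0, ∀ i, (q : ℂ) ^ lam q i = z i) :
    Tendsto (fun q : ℝ => qWhittakerFun ℓ q (lam q) p) (𝓝[>] 0) (𝓝 (gzChar ℓ p z)) := by
  simp only [qWhittakerFun, gzChar, if_pos hp]
  refine tendsto_finsetSum _ fun P _ => ?_
  have hweight : Tendsto (fun q : ℝ => (qWeight ℓ q P : ℂ)) (𝓝[>] 0) (𝓝 1) :=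
    (Complex.continuous_ofReal.tendsto 1).comp (tendsto_qWeight ℓ P)
  rw [← mul_one (∏ k, _)]
  refine (tendsto_const_nhds.mul hweight).congr' ?_
  filter_upwards [h] with q hq
  simp only [Complex.cpow_mul_int, hq]

end Limit

section Pieri

theorem exteriorPower_map_ιMulti_family_of_diagonal {ι R M : Type*} [LinearOrder ι] [CommRing R]
    [AddCommGroup M] [Module R M] {f : M →ₗ[R] M} {v : ι → M} {c : ι → R}
    (hf : ∀ i, f (v i) = c i • v i) {r : ℕ} (s : Set.powersetCard ι r) :
    exteriorPower.map r f (exteriorPower.ιMulti_family R r v s) =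
      (∏ i ∈ (s : Finset ι), c i) • exteriorPower.ιMulti_family R r v s := by
  have hprod : ∏ i ∈ (s : Finset ι), c i = ∏ k, c (Set.powersetCard.ofFinEmbEquiv.symm s k) := by
    conv_lhs => rw [← Finset.map_orderEmbOfFin_univ (s : Finset ι) (Set.powersetCard.card_eq s)]
    rw [Finset.prod_map]
    rfl
  have hcomp : (f ∘ v) ∘ Set.powersetCard.ofFinEmbEquiv.symm s = fun k =>
      c (Set.powersetCard.ofFinEmbEquiv.symm s k) •
        (v ∘ Set.powersetCard.ofFinEmbEquiv.symm s) k :=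
    funext fun k => hf _
  rw [exteriorPower.map_apply_ιMulti_family, exteriorPower.ιMulti_family,
    exteriorPower.ιMulti_family, hprod, ← AlternatingMap.map_smul_univ, ← hcomp]

theorem trace_exteriorPower_map_of_diagonal {ι R M : Type*} [Fintype ι] [LinearOrder ι]
    [CommRing R] [AddCommGroup M] [Module R M] (b : Module.Basis ι R M) {f : M →ₗ[R] M}
    {c : ι → R} (hf : ∀ i, f (b i) = c i • b i) (r : ℕ) :
    LinearMap.trace R (⋀[R]^r M) (exteriorPower.map r f) =
      ∑ I ∈ Finset.powersetCard r (Finset.univ : Finset ι), ∏ i ∈ I, c i := by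
  have hdiag (s : Set.powersetCard ι r) :
      LinearMap.toMatrix (b.exteriorPower r) (b.exteriorPower r) (exteriorPower.map r f) s s =
        ∏ i ∈ (s : Finset ι), c i := by
    rw [LinearMap.toMatrix_apply, exteriorPower.basis_apply,
      exteriorPower_map_ιMulti_family_of_diagonal hf, map_smul, exteriorPower.basis_repr]
    simp
  rw [LinearMap.trace_eq_matrix_trace R (b.exteriorPower r), Matrix.trace]
  simp only [Matrix.diag_apply, hdiag]
  exact (Finset.sum_subtype _ (fun I => by simp [Set.powersetCard.mem_iff])
    fun I => ∏ i ∈ I, c i).symm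

theorem fundChar_eq {n : ℕ} (r : ℕ) (z : Fin n → ℂˣ) :
    fundChar r z = ∑ I ∈ Finset.powersetCard r (Finset.univ : Finset (Fin n)),
      ∏ i ∈ I, (z i : ℂ) :=
  trace_exteriorPower_map_of_diagonal (Pi.basisFun ℂ (Fin n)) (fun i => by
    simp [Matrix.toLin'_apply, ← Pi.single_smul]) r

section Esymm

variable {ι K : Type*} [Fintype ι] [DecidableEq ι] [CommRing K]

/-- The elementary symmetric polynomial of degree `r` as a Laurent polynomial. -/
noncomputable def esymmLaurent (ι K : Type*) [Fintype ι] [DecidableEq ι] [CommRing K] (r : ℕ) :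
    Laurent ι K :=
  MvPolynomial.aeval laurentVar (MvPolynomial.esymm ι K r)

theorem permVars_esymmLaurent (σ : Equiv.Perm ι) (r : ℕ) :
    permVars σ (esymmLaurent ι K r) = esymmLaurent ι K r := by
  have hvar : (permVars σ : Laurent ι K → Laurent ι K) ∘ laurentVar = laurentVar ∘ σ := by
    funext i
    rw [Function.comp_apply, laurentVar, permVars_single, Pi.single_comp_equiv, Equiv.symm_symm]
    rfl
  conv_rhs => rw [esymmLaurent, ← MvPolynomial.rename_esymm ι K r σ, MvPolynomial.aeval_rename]
  rw [← hvar, esymmLaurent]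
  exact MvPolynomial.comp_aeval_apply (f := laurentVar) (permVars (K := K) σ).toAlgHom _

theorem alternant_eq_sum_permVars (ν : ι → ℤ) :
    (alternant ν : Laurent ι K) = ∑ σ : Equiv.Perm ι, ((Equiv.Perm.sign σ : ℤ) : K) •
      permVars σ.symm (AddMonoidAlgebra.single ν 1) := by
  simp only [alternant_eq_sum, permVars_single, Equiv.symm_symm]

end Esymm

variable {n : ℕ} {K : Type*}

theorem torusEval_esymmLaurent (r : ℕ) (z : Fin n → ℂˣ) :
    torusEval z (esymmLaurent (Fin n) ℂ r) = fundChar r z := by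
  simp only [esymmLaurent, MvPolynomial.esymm, map_sum, map_prod, MvPolynomial.aeval_X, laurentVar,
    torusEval_single, torusChar_single, one_mul, zpow_one, fundChar_eq]

section CommRing

variable [CommRing K]

theorem esymmLaurent_mul_single (r : ℕ) (ν : Fin n → ℤ) :
    esymmLaurent (Fin n) K r * AddMonoidAlgebra.single ν 1 =
      ∑ I ∈ Finset.powersetCard r Finset.univ, AddMonoidAlgebra.single (shift ν I) 1 := by
  simp only [esymmLaurent, MvPolynomial.esymm, map_sum, map_prod, MvPolynomial.aeval_X, laurentVar,
    Finset.sum_mul, AddMonoidAlgebra.prod_single, AddMonoidAlgebra.single_mul_single,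
    Finset.prod_const_one, one_mul]
  refine Finset.sum_congr rfl fun I _ => ?_
  congr 1
  funext i
  simp [shift, Finset.sum_apply, Pi.single_apply, add_comm]

theorem esymmLaurent_mul_alternant (r : ℕ) (ν : Fin n → ℤ) :
    esymmLaurent (Fin n) K r * alternant ν =
      ∑ I ∈ Finset.powersetCard r Finset.univ, alternant (shift ν I) := by
  simp only [alternant_eq_sum_permVars, Finset.mul_sum, mul_smul_comm]
  rw [Finset.sum_comm]
  refine Finset.sum_congr rfl fun σ _ => ?_
  rw [← permVars_esymmLaurent σ.symm, ← map_mul, esymmLaurent_mul_single, map_sum, Finset.smul_sum]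

end CommRing

theorem shift_add (p ν : Fin n → ℤ) (I : Finset (Fin n)) :
    shift (p + ν) I = shift p I + ν := by
  funext i
  simp only [shift, Pi.add_apply]
  ring

/- A descent of `p + I` is by exactly `1`, so adding `delta` makes two exponents equal. -/
theorem alternant_shift_add_delta_eq_zero [CommRing K] {p : Fin n → ℤ} (hp : Monotone p)
    {I : Finset (Fin n)} (h : ¬Monotone (shift p I)) :
    (alternant (shift p I + delta n) : Laurent (Fin n) K) = 0 := by
  cases n with
  | zero => exact absurd (fun i => i.elim0) h
  | succ n =>
    rw [Fin.monotone_iff_le_succ] at h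
    push Not at h
    obtain ⟨i, hi⟩ := h
    have hpi := hp (Fin.castSucc_le_succ i)
    refine alternant_eq_zero (Fin.castSucc_lt_succ (i := i)).ne ?_
    simp only [shift, delta, Pi.add_apply, Fin.val_succ, Fin.val_castSucc] at hi ⊢
    push_cast
    split_ifs at hi ⊢ <;> omega

variable {ℓ : ℕ} {p : Fin (ℓ + 1) → ℤ}

open Classical in
theorem esymmLaurent_mul_gzLaurent [Field K] [CharZero K] (hp : Monotone p) (r : ℕ) :
    esymmLaurent (Fin (ℓ + 1)) K r * gzLaurent K ℓ p =
      ∑ I ∈ Finset.powersetCard r Finset.univ,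
        if Monotone (shift p I) then gzLaurent K ℓ (shift p I) else 0 := by
  refine mul_left_cancel₀ (alternant_delta_ne_zero (n := ℓ + 1)) ?_
  rw [mul_left_comm, alternant_delta_mul_gzLaurent hp, esymmLaurent_mul_alternant, Finset.mul_sum]
  refine Finset.sum_congr rfl fun I _ => ?_
  rw [shift_add]
  split_ifs with h
  · rw [alternant_delta_mul_gzLaurent h]
  · rw [alternant_shift_add_delta_eq_zero hp h, mul_zero]

theorem fundChar_mul_gzChar (hp : Monotone p) (r : ℕ) (z : Fin (ℓ + 1) → ℂˣ) :
    fundChar r z * gzChar ℓ p z =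
      ∑ I ∈ Finset.powersetCard r Finset.univ, gzChar ℓ (shift p I) z := by
  classical
  rw [← torusEval_esymmLaurent, gzChar_eq_torusEval hp, ← map_mul, esymmLaurent_mul_gzLaurent hp,
    map_sum]
  refine Finset.sum_congr rfl fun I _ => ?_
  split_ifs with h
  · rw [gzChar_eq_torusEval h]
  · rw [gzChar, if_neg h, map_zero]

end Pieri

/-! ### Highest weight modules of the general linear Lie algebra -/

section GeneralLinearLieAlgebra

attribute [local instance] LieRing.ofAssociativeRing

variable {ι R A : Type*} [Fintype ι] [DecidableEq ι] [CommRing R] [Ring A] [Algebra R A]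

theorem map_mul_map (φ : Matrix ι ι R →ₗ⁅R⁆ A) (X Y : Matrix ι ι R) :
    φ X * φ Y = φ Y * φ X + φ (X * Y - Y * X) := by
  rw [← Ring.lie_def, LieHom.map_lie, Ring.lie_def, add_sub_cancel]

theorem map_single_mul_map_single (φ : Matrix ι ι R →ₗ⁅R⁆ A) (k l i j : ι) :
    φ (.single k l 1) * φ (.single i j 1) = φ (.single i j 1) * φ (.single k l 1) +
      ((if l = i then φ (.single k j 1) else 0) - if j = k then φ (.single i l 1) else 0) := by
  have hmul (a b c d : ι) : φ (.single a b 1 * .single c d 1) =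
      if b = c then φ (.single a d 1) else 0 := by
    split_ifs with h
    · rw [h, Matrix.single_mul_single_same, mul_one]
    · rw [Matrix.single_mul_single_of_ne _ _ _ _ h, map_zero]
  rw [map_mul_map, map_sub, hmul, hmul]

/-- The image of the quadratic Casimir element `∑ i j, E_{ij} E_{ji}` of `𝔤𝔩_n` under a
representation in an associative algebra. -/
def casimir (φ : Matrix ι ι R →ₗ⁅R⁆ A) : A :=
  ∑ i, ∑ j, φ (.single i j 1) * φ (.single j i 1)

theorem commute_map_single_casimir (φ : Matrix ι ι R →ₗ⁅R⁆ A) (k l : ι) :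
    Commute (φ (.single k l 1)) (casimir φ) := by
  have hterm (i j : ι) : φ (.single k l 1) * (φ (.single i j 1) * φ (.single j i 1)) =
      φ (.single i j 1) * φ (.single j i 1) * φ (.single k l 1) +
        (((if l = i then φ (.single k j 1) * φ (.single j i 1) else 0) -
            if j = k then φ (.single i l 1) * φ (.single j i 1) else 0) +
          ((if l = j then φ (.single i j 1) * φ (.single k i 1) else 0) -
            if i = k then φ (.single i j 1) * φ (.single j l 1) else 0)) := by
    rw [← mul_assoc, map_single_mul_map_single φ k l i j, add_mul, mul_assoc,
      map_single_mul_map_single φ k l j i, mul_add, sub_mul, mul_sub]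
    simp only [ite_mul, mul_ite, zero_mul, mul_zero, mul_assoc]
    abel
  rw [Commute, SemiconjBy, casimir]
  simp only [Finset.mul_sum, Finset.sum_mul, hterm, Finset.sum_add_distrib,
    Finset.sum_sub_distrib]
  rw [Finset.sum_comm (f := fun i j => if l = i then _ else _),
    Finset.sum_comm (f := fun i j => if i = k then _ else _)]
  simp

end GeneralLinearLieAlgebra

section HighestWeightModules

attribute [local instance] LieRing.ofAssociativeRing

variable {ι R V : Type*} [Fintype ι] [DecidableEq ι] [CommRing R] [AddCommGroup V] [Module R V]
  {φ : Matrix ι ι R →ₗ⁅R⁆ Module.End R V} {μ w : ι → ℤ} {v x : V}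

/-- The vector `x` of a `𝔤𝔩_n`-module has weight `μ`: the diagonal matrix units act on it by the
coordinates of `μ`. -/
def IsWeightVector (φ : Matrix ι ι R →ₗ⁅R⁆ Module.End R V) (μ : ι → ℤ) (x : V) : Prop :=
  ∀ i, φ (.single i i 1) x = (μ i : R) • x

theorem IsWeightVector.map_single (hx : IsWeightVector φ μ x) (i j : ι) :
    IsWeightVector φ (μ + (Pi.single i 1 - Pi.single j 1)) (φ (.single i j 1) x) := by
  intro k
  rw [← Module.End.mul_apply, map_single_mul_map_single, LinearMap.add_apply,
    Module.End.mul_apply, hx k, map_smul, LinearMap.sub_apply]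
  simp only [Pi.add_apply, Pi.sub_apply, Pi.single_apply, Int.cast_add, Int.cast_sub, add_smul,
    sub_smul, eq_comm (a := j)]
  rcases eq_or_ne k i with rfl | hi <;> rcases eq_or_ne k j with rfl | hj <;> simp [*]

theorem IsWeightVector.casimir (hx : IsWeightVector φ μ x) :
    IsWeightVector φ μ (casimir φ x) := fun i => by
  rw [← Module.End.mul_apply, (commute_map_single_casimir φ i i).eq, Module.End.mul_apply, hx i,
    map_smul]

variable [LinearOrder ι]

/-- A highest weight vector of weight `w` of a `𝔤𝔩_n`-module: it has weight `w` and is annihilated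
by the strictly upper triangular matrices. -/
structure IsHighestWeightVector (φ : Matrix ι ι R →ₗ⁅R⁆ Module.End R V) (w : ι → ℤ) (v : V) :
    Prop where
  ne_zero : v ≠ 0
  isWeightVector : IsWeightVector φ w v
  map_single_eq_zero : ∀ i j, i < j → φ (.single i j 1) v = 0

/-- `IsLowering φ w v μ x` says that `x` is obtained from `v` by a sequence of strictly lower
triangular matrix units; the index `μ` keeps track of the weight, starting from `w` at `v`. -/
inductive IsLowering (φ : Matrix ι ι R →ₗ⁅R⁆ Module.End R V) (w : ι → ℤ) (v : V) :
    (ι → ℤ) → V → Prop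
  | base : IsLowering φ w v w v
  | step {μ : ι → ℤ} {x : V} {i j : ι} (hji : j < i) : IsLowering φ w v μ x →
      IsLowering φ w v (μ + (Pi.single i 1 - Pi.single j 1)) (φ (.single i j 1) x)

theorem IsLowering.isWeightVector (hv : IsWeightVector φ w v) (h : IsLowering φ w v μ x) :
    IsWeightVector φ μ x := by
  induction h with
  | base => exact hv
  | step _ _ ih => exact ih.map_single _ _

theorem IsLowering.dominatedBy (h : IsLowering φ w v μ x) : DominatedBy μ w := by
  induction h with
  | base => exact .refl w
  | step hji _ ih => exact ih.add_single_sub_single hji.le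

theorem IsLowering.eq_of_weight_eq (h : IsLowering φ w v μ x) (hμ : μ = w) : x = v := by
  cases h with
  | base => rfl
  | @step μ x i j hji h =>
    have hle : DominatedBy w μ := hμ ▸ (DominatedBy.refl μ).add_single_sub_single hji.le
    have hroot := congrFun (hμ.trans (hle.antisymm h.dominatedBy)) i
    simp [hji.ne'] at hroot

/-- The span of all vectors obtained from `v` by strictly lower triangular matrix units. -/
def lowerSpan (φ : Matrix ι ι R →ₗ⁅R⁆ Module.End R V) (w : ι → ℤ) (v : V) : Submodule R V :=
  .span R {x | ∃ μ, IsLowering φ w v μ x}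

theorem IsLowering.mem_lowerSpan (h : IsLowering φ w v μ x) : x ∈ lowerSpan φ w v :=
  Submodule.subset_span ⟨μ, h⟩

theorem lowerSpan_le_comap_map_single {i j : ι} (hji : j < i) :
    lowerSpan φ w v ≤ (lowerSpan φ w v).comap (φ (.single i j 1)) :=
  Submodule.span_le.mpr fun _ ⟨_, h⟩ => (h.step hji).mem_lowerSpan

theorem IsHighestWeightVector.map_mem_lowerSpan (hv : IsHighestWeightVector φ w v)
    (X : Matrix ι ι R) : φ X v ∈ lowerSpan φ w v := by
  induction X using Matrix.induction_on' with
  | h_zero => simp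
  | h_add X Y hX hY => simpa using Submodule.add_mem _ hX hY
  | h_std_basis i j c =>
    rw [← mul_one c, ← smul_eq_mul, ← Matrix.smul_single, map_smul]
    refine Submodule.smul_mem _ c ?_
    rcases lt_trichotomy i j with hij | rfl | hji
    · simp [hv.map_single_eq_zero i j hij]
    · rw [hv.isWeightVector i]
      exact Submodule.smul_mem _ _ IsLowering.base.mem_lowerSpan
    · exact (IsLowering.base.step hji).mem_lowerSpan

theorem IsHighestWeightVector.lowerSpan_le_comap_map (hv : IsHighestWeightVector φ w v)
    (X : Matrix ι ι R) : lowerSpan φ w v ≤ (lowerSpan φ w v).comap (φ X) := by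
  refine Submodule.span_le.mpr ?_
  rintro x ⟨μ, h⟩
  change φ X x ∈ lowerSpan φ w v
  induction h generalizing X with
  | base => exact hv.map_mem_lowerSpan X
  | @step _ x i j hji _ ih =>
    rw [← Module.End.mul_apply, map_mul_map, LinearMap.add_apply]
    exact Submodule.add_mem _ (lowerSpan_le_comap_map_single hji (ih X)) (ih _)

end HighestWeightModules

section WeightDecompositions

attribute [local instance] LieRing.ofAssociativeRing

variable {ι K V : Type*} [Fintype ι] [DecidableEq ι] [Field K] [AddCommGroup V] [Module K V]
  {φ : Matrix ι ι K →ₗ⁅K⁆ Module.End K V} {P : (ι → ℤ) →₀ Module.End K V} {μ : ι → ℤ} {x : V}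

/-- `P` is the family of projections of a `𝔤𝔩_n`-module onto its weight spaces; in particular the
module is the sum of finitely many weight spaces. -/
structure IsWeightDecomposition (φ : Matrix ι ι K →ₗ⁅K⁆ Module.End K V)
    (P : (ι → ℤ) →₀ Module.End K V) : Prop where
  sum_eq_one : (P.sum fun _ T => T) = 1
  map_single_mul : ∀ μ i, φ (.single i i 1) * P μ = (μ i : K) • P μ
  mul_map_single : ∀ μ i, P μ * φ (.single i i 1) = (μ i : K) • P μ

theorem IsWeightDecomposition.isWeightVector (hP : IsWeightDecomposition φ P) (μ : ι → ℤ)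
    (x : V) : IsWeightVector φ μ (P μ x) := fun i =>
  LinearMap.congr_fun (hP.map_single_mul μ i) x

theorem IsWeightDecomposition.sum_apply (hP : IsWeightDecomposition φ P) (x : V) :
    ∑ μ ∈ P.support, P μ x = x := by
  simpa [Finsupp.sum] using LinearMap.congr_fun hP.sum_eq_one x

theorem IsWeightDecomposition.hom_ext (hP : IsWeightDecomposition φ P) {W : Type*}
    [AddCommGroup W] [Module K W] {S T : V →ₗ[K] W}
    (h : ∀ μ x, IsWeightVector φ μ x → S x = T x) : S = T := by
  ext x
  rw [← hP.sum_apply x, map_sum, map_sum]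
  exact Finset.sum_congr rfl fun μ _ => h μ _ (hP.isWeightVector μ x)

variable [CharZero K]

theorem IsWeightDecomposition.apply_of_ne (hP : IsWeightDecomposition φ P)
    (hx : IsWeightVector φ μ x) {ν : ι → ℤ} (hν : ν ≠ μ) : P ν x = 0 := by
  obtain ⟨i, hi⟩ := Function.ne_iff.mp hν
  have heq : (ν i : K) • P ν x = (μ i : K) • P ν x := by
    rw [← LinearMap.smul_apply, ← hP.mul_map_single, Module.End.mul_apply, hx i, map_smul]
  rw [← sub_eq_zero, ← sub_smul] at heq
  exact (smul_eq_zero.mp heq).resolve_left (sub_ne_zero.mpr (Int.cast_injective.ne hi))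

theorem IsWeightDecomposition.apply_self (hP : IsWeightDecomposition φ P)
    (hx : IsWeightVector φ μ x) : P μ x = x := by
  conv_rhs => rw [← hP.sum_apply x]
  refine (Finset.sum_eq_single μ (fun ν _ hν => hP.apply_of_ne hx hν) fun hμ => ?_).symm
  rw [Finsupp.notMem_support_iff.mp hμ, LinearMap.zero_apply]

theorem IsWeightDecomposition.mul_map_single_eq (hP : IsWeightDecomposition φ P) (μ : ι → ℤ)
    (i j : ι) : P (μ + (Pi.single i 1 - Pi.single j 1)) * φ (.single i j 1) =
      φ (.single i j 1) * P μ := by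
  refine hP.hom_ext fun ν x hx => ?_
  rw [Module.End.mul_apply, Module.End.mul_apply]
  rcases eq_or_ne μ ν with rfl | hν
  · rw [hP.apply_self hx, hP.apply_self (hx.map_single i j)]
  · rw [hP.apply_of_ne hx hν, hP.apply_of_ne (hx.map_single i j) (by simpa using hν), map_zero]

section Generated

variable [LinearOrder ι] {w : ι → ℤ} {v : V}

theorem IsWeightDecomposition.eq_zero_of_not_dominatedBy (hP : IsWeightDecomposition φ P)
    (hv : IsHighestWeightVector φ w v) (htop : lowerSpan φ w v = ⊤) (hμ : ¬ DominatedBy μ w) :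
    P μ = 0 := by
  refine LinearMap.ext_on htop ?_
  rintro x ⟨ν, hx⟩
  exact hP.apply_of_ne (hx.isWeightVector hv.isWeightVector)
    (ne_of_apply_ne (DominatedBy · w) (by simp [hμ, hx.dominatedBy]))

theorem IsWeightDecomposition.isProj (hP : IsWeightDecomposition φ P)
    (hv : IsHighestWeightVector φ w v) (htop : lowerSpan φ w v = ⊤) :
    LinearMap.IsProj (K ∙ v) (P w) := by
  constructor
  · suffices lowerSpan φ w v ≤ (K ∙ v).comap (P w) from fun x => this (htop ▸ Submodule.mem_top)
    refine Submodule.span_le.mpr ?_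
    rintro x ⟨ν, hx⟩
    change P w x ∈ K ∙ v
    have hxν := hx.isWeightVector hv.isWeightVector
    rcases eq_or_ne w ν with rfl | hν
    · rw [hP.apply_self hxν, hx.eq_of_weight_eq rfl]
      exact Submodule.mem_span_singleton_self v
    · rw [hP.apply_of_ne hxν hν]
      exact Submodule.zero_mem _
  · intro x hx
    obtain ⟨c, rfl⟩ := Submodule.mem_span_singleton.mp hx
    rw [map_smul, hP.apply_self hv.isWeightVector]

theorem IsWeightDecomposition.exists_casimir_eq_smul_one (hP : IsWeightDecomposition φ P)
    (hv : IsHighestWeightVector φ w v) (htop : lowerSpan φ w v = ⊤) :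
    ∃ c : K, casimir φ = c • 1 := by
  obtain ⟨c, hc⟩ := Submodule.mem_span_singleton.mp ((hP.isProj hv htop).map_mem (casimir φ v))
  rw [hP.apply_self hv.isWeightVector.casimir] at hc
  refine ⟨c, LinearMap.ext_on htop ?_⟩
  rintro x ⟨μ, hx⟩
  induction hx with
  | base => exact hc.symm
  | @step μ x i j _ _ ih =>
    rw [← Module.End.mul_apply, ← (commute_map_single_casimir φ i j).eq, Module.End.mul_apply, ih]
    simp

end Generated

end WeightDecompositions

/-! ### The Weyl character formula -/

section FormalTraces

attribute [local instance] LieRing.ofAssociativeRing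

variable {ι K V : Type*} [Field K] [AddCommGroup V] [Module K V]

/-- The generating function `∑ μ, tr (P μ ∘ M) z ^ μ` of the traces of the components of the
endomorphism `M`; for the projections `P μ` onto the weight spaces and `M = 1` it is the formal
character. -/
noncomputable def formalTrace (P : (ι → ℤ) →₀ Module.End K V) :
    Module.End K V →ₗ[K] Laurent ι K where
  toFun M := .ofCoeff (P.mapRange (fun T => LinearMap.trace K V (T * M)) (by simp))
  map_add' M N := by
    ext μ
    simp [mul_add]
  map_smul' c M := by
    ext μ
    simp

theorem coeff_formalTrace (P : (ι → ℤ) →₀ Module.End K V) (M : Module.End K V) (μ : ι → ℤ) :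
    (formalTrace P M).coeff μ = LinearMap.trace K V (P μ * M) := rfl

variable [Fintype ι] [DecidableEq ι] {φ : Matrix ι ι K →ₗ⁅K⁆ Module.End K V}
  {P : (ι → ℤ) →₀ Module.End K V}

theorem IsWeightDecomposition.formalTrace_map_single_self_mul (hP : IsWeightDecomposition φ P)
    (i : ι) (M : Module.End K V) :
    formalTrace P (φ (.single i i 1) * M) = eulerDeriv i (formalTrace P M) := by
  ext μ
  rw [coeff_formalTrace, ← mul_assoc, hP.mul_map_single, smul_mul_assoc, map_smul,
    coeff_eulerDeriv, coeff_formalTrace, smul_eq_mul]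

theorem IsWeightDecomposition.formalTrace_map_single_mul_map_single_comm
    (hP : IsWeightDecomposition φ P) (i j : ι) :
    formalTrace P (φ (.single i j 1) * φ (.single j i 1)) =
      formalTrace P (φ (.single j i 1) * φ (.single i j 1)) +
        (eulerDeriv i (formalTrace P 1) - eulerDeriv j (formalTrace P 1)) := by
  rw [map_single_mul_map_single, map_add, if_pos rfl, if_pos rfl, map_sub,
    ← hP.formalTrace_map_single_self_mul, ← hP.formalTrace_map_single_self_mul, mul_one, mul_one]

theorem IsWeightDecomposition.laurentVar_mul_formalTrace [CharZero K]
    (hP : IsWeightDecomposition φ P) (i j : ι) :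
    laurentVar i * formalTrace P (φ (.single j i 1) * φ (.single i j 1)) =
      laurentVar j * formalTrace P (φ (.single i j 1) * φ (.single j i 1)) := by
  ext μ
  have hμ : μ - Pi.single i 1 = μ - Pi.single j 1 + (Pi.single j 1 - Pi.single i 1) := by abel
  rw [coeff_laurentVar_mul, coeff_laurentVar_mul, coeff_formalTrace, coeff_formalTrace,
    ← mul_assoc, hμ, hP.mul_map_single_eq, mul_assoc, LinearMap.trace_mul_comm, mul_assoc]

end FormalTraces

section WeylCharacterFormula

attribute [local instance] LieRing.ofAssociativeRing

variable {n : ℕ} {K V : Type*} [Field K] [AddCommGroup V] [Module K V]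
  {φ : Matrix (Fin n) (Fin n) K →ₗ⁅K⁆ Module.End K V} {P : (Fin n → ℤ) →₀ Module.End K V}
  {w : Fin n → ℤ} {v : V}

theorem IsWeightDecomposition.formalTrace_casimir (hP : IsWeightDecomposition φ P) :
    formalTrace P (casimir φ) = laplacian (formalTrace P 1) +
      ∑ i, ∑ j ∈ Finset.Ioi i, (formalTrace P (φ (.single i j 1) * φ (.single j i 1)) +
        formalTrace P (φ (.single j i 1) * φ (.single i j 1))) := by
  have hdiag (i : Fin n) : eulerDeriv i (eulerDeriv i (formalTrace P 1)) =
      formalTrace P (φ (.single i i 1) * φ (.single i i 1)) := by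
    rw [hP.formalTrace_map_single_self_mul, ← hP.formalTrace_map_single_self_mul, mul_one]
  rw [Finset.sum_sum_Ioi_add_eq_sum_sum_off_diag
    (fun j i => formalTrace P (φ (.single i j 1) * φ (.single j i 1))), laplacian_apply, casimir]
  simp only [map_sum, hdiag, ← Finset.sum_add_distrib]
  exact Finset.sum_congr rfl fun i _ => Fintype.sum_eq_add_sum_compl i _

variable [CharZero K]

theorem IsWeightDecomposition.dominatedBy_of_coeff_formalTrace_ne_zero
    (hP : IsWeightDecomposition φ P) (hv : IsHighestWeightVector φ w v)
    (htop : lowerSpan φ w v = ⊤) {M : Module.End K V} {μ : Fin n → ℤ}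
    (h : (formalTrace P M).coeff μ ≠ 0) : DominatedBy μ w := by
  by_contra hμ
  rw [coeff_formalTrace, hP.eq_zero_of_not_dominatedBy hv htop hμ, zero_mul, map_zero] at h
  exact h rfl

theorem IsWeightDecomposition.sum_eulerDeriv_formalTrace (hP : IsWeightDecomposition φ P)
    (hv : IsHighestWeightVector φ w v) (htop : lowerSpan φ w v = ⊤) (M : Module.End K V) :
    ∑ i, eulerDeriv i (formalTrace P M) = ((∑ i, w i : ℤ) : K) • formalTrace P M := by
  ext μ
  rw [AddMonoidAlgebra.coeff_sum, Finset.sum_apply', AddMonoidAlgebra.coeff_smul_apply]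
  simp only [coeff_eulerDeriv]
  rw [← Finset.sum_mul, ← Int.cast_sum, smul_eq_mul]
  by_cases h : (formalTrace P M).coeff μ = 0
  · rw [h, mul_zero, mul_zero]
  · rw [(hP.dominatedBy_of_coeff_formalTrace_ne_zero hv htop h).sum_eq]

/- The off-diagonal part of the Casimir element, which is central, contributes exactly the first
order term by which conjugation with the Vandermonde determinant changes the Laplacian. -/
theorem IsWeightDecomposition.exists_laplacian_eq_smul (hP : IsWeightDecomposition φ P)
    (hv : IsHighestWeightVector φ w v) (htop : lowerSpan φ w v = ⊤) :
    ∃ κ : K, laplacian (alternant (delta n) * formalTrace P 1) =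
      κ • (alternant (delta n) * formalTrace P 1) := by
  set X := formalTrace P 1
  let T (i j : Fin n) := formalTrace P (φ (.single i j 1) * φ (.single j i 1)) +
    formalTrace P (φ (.single j i 1) * φ (.single i j 1))
  obtain ⟨c, hc⟩ := hP.exists_casimir_eq_smul_one hv htop
  have hcasimir : ∑ i, ∑ j ∈ Finset.Ioi i, T i j = c • X - laplacian X := by
    rw [eq_sub_iff_add_eq', ← hP.formalTrace_casimir, hc, map_smul]
  have hT (i j : Fin n) (_ : i < j) : (laurentVar j - laurentVar i) * T i j =
      (laurentVar i + laurentVar j) * (eulerDeriv j X - eulerDeriv i X) := by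
    linear_combination (-2) * hP.laurentVar_mul_formalTrace i j -
      (laurentVar i + laurentVar j) * hP.formalTrace_map_single_mul_map_single_comm i j
  have hdegree : ∑ i, ∑ j ∈ Finset.Ioi i, (eulerDeriv i X + eulerDeriv j X) =
      (n - 1) • ((∑ i, w i : ℤ) : K) • X := by
    rw [Finset.sum_sum_Ioi_add_eq_sum_sum_off_diag (fun _ i => eulerDeriv i X),
      ← hP.sum_eulerDeriv_formalTrace hv htop, Finset.smul_sum]
    simp [X, Finset.card_compl]
  refine ⟨((delta n ⬝ᵥ delta n : ℤ) : K) + c + ((n - 1 : ℕ) : K) * ((∑ i, w i : ℤ) : K), ?_⟩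
  rw [laplacian_mul, two_mul_sum_eulerDeriv_alternant_delta X T hT, laplacian_alternant]
  simp only [Finset.sum_add_distrib] at hcasimir hdegree ⊢
  rw [hcasimir, hdegree, ← Nat.cast_smul_eq_nsmul K, smul_smul]
  simp only [mul_add, mul_sub, mul_smul_comm, smul_mul_assoc, add_smul]
  abel

theorem IsWeightDecomposition.coeff_formalTrace_one_self [FiniteDimensional K V]
    (hP : IsWeightDecomposition φ P) (hv : IsHighestWeightVector φ w v)
    (htop : lowerSpan φ w v = ⊤) : (formalTrace P 1).coeff w = 1 := by
  rw [coeff_formalTrace, mul_one, (hP.isProj hv htop).trace, finrank_span_singleton hv.ne_zero,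
    Nat.cast_one]

theorem IsWeightDecomposition.alternant_delta_mul_formalTrace_one [FiniteDimensional K V]
    {p : Fin n → ℤ} (hp : Monotone p) (hP : IsWeightDecomposition φ P)
    (hv : IsHighestWeightVector φ (p ∘ Fin.rev) v) (htop : lowerSpan φ (p ∘ Fin.rev) v = ⊤)
    (hsymm : ∀ σ, permVars σ (formalTrace P 1) = formalTrace P 1) :
    alternant (delta n) * formalTrace P 1 = alternant (p + delta n) := by
  have hν : StrictMono (p + delta n) := strictMono_add_delta hp
  have hδ : StrictMono (delta n) := delta_strictMono n
  have hdomδ (μ : Fin n → ℤ) (h : (alternant (delta n) : Laurent _ K).coeff μ ≠ 0) :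
      DominatedBy μ (delta n ∘ Fin.rev) :=
    dominatedBy_rev_of_coeff_alternant_ne_zero hδ.monotone h
  have hdomX (μ : Fin n → ℤ) (h : (formalTrace P 1).coeff μ ≠ 0) :
      DominatedBy μ (p ∘ Fin.rev) :=
    hP.dominatedBy_of_coeff_formalTrace_ne_zero hv htop h
  have hrev : (p + delta n) ∘ Fin.rev = delta n ∘ Fin.rev + p ∘ Fin.rev := add_comm _ _
  obtain ⟨κ, hκ⟩ := hP.exists_laplacian_eq_smul hv htop
  refine ((isAlternating_alternant _).mul_of_symmetric hsymm).eq_alternant hν hκ ?_ ?_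
  · exact fun μ hμ => hrev ▸ dominatedBy_of_coeff_mul_ne_zero hdomδ hdomX hμ
  · rw [coeff_alternant_rev hν.injective, hrev, coeff_mul_of_dominatedBy hdomδ hdomX,
      hP.coeff_formalTrace_one_self hv htop, mul_one, coeff_alternant_rev hδ.injective]

end WeylCharacterFormula

/-! ### Rational representations and their differentials -/

section Functionals

variable {K V : Type*} [Field K] [AddCommGroup V] [Module K V]

theorem eq_of_forall_dual_eq {x y : V} (h : ∀ f : Module.Dual K V, f x = f y) : x = y := by
  rw [← sub_eq_zero, ← Module.forall_dual_apply_eq_zero_iff K]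
  exact fun f => by rw [map_sub, h, sub_self]

theorem coord_end_apply {κ : Type*} [Fintype κ] [DecidableEq κ] (b : Module.Basis κ K V)
    (ij : κ × κ) (T : Module.End K V) : b.end.coord ij T = b.coord ij.1 (T (b ij.2)) := by
  simp [Matrix.stdBasis, LinearMap.toMatrix_apply]

end Functionals

section Velocities

variable {n : ℕ} {g : ℂ → GL (Fin n) ℂ} {A : Matrix (Fin n) (Fin n) ℂ}

/-- `g` is a curve in `GL_n(ℂ)` which passes through the identity at time `0` with velocity `A`. -/
structure HasVelocity (g : ℂ → GL (Fin n) ℂ) (A : Matrix (Fin n) (Fin n) ℂ) : Prop where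
  map_zero : g 0 = 1
  hasDerivAt : ∀ i j, HasDerivAt (fun t => (g t).val i j) (A i j) 0

theorem exists_hasVelocity (A : Matrix (Fin n) (Fin n) ℂ) : ∃ g, HasVelocity g A := by
  classical
  have hdet : ∀ᶠ t in 𝓝 (0 : ℂ), (1 + t • A).det ≠ 0 := by
    have hcont : Continuous fun t : ℂ => (1 + t • A).det := by fun_prop
    exact hcont.continuousAt.eventually_ne (by simp)
  refine ⟨fun t => if h : (1 + t • A).det ≠ 0 then .mkOfDetNeZero _ h else 1, ?_, fun i j => ?_⟩
  · ext
    simp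
  · have hline : HasDerivAt (fun t : ℂ => (1 + t • A) i j) (A i j) 0 := by
      simpa using ((hasDerivAt_id (0 : ℂ)).mul_const (A i j)).const_add
        ((1 : Matrix (Fin n) (Fin n) ℂ) i j)
    refine hline.congr_of_eventuallyEq ?_
    filter_upwards [hdet] with t ht
    rw [dif_pos ht]
    rfl

theorem HasVelocity.conj (hg : HasVelocity g A) (h : GL (Fin n) ℂ) :
    HasVelocity (fun t => h * g t * h⁻¹) (h.val * A * h⁻¹.val) := by
  refine ⟨by simp [hg.map_zero], fun i j => ?_⟩
  simp only [Units.val_mul, Matrix.mul_apply]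
  exact .fun_sum fun k _ => .mul_const (.fun_sum fun l _ => (hg.hasDerivAt l k).const_mul _) _

theorem hasVelocity_transvection {i j : Fin n} (hij : i ≠ j) :
    HasVelocity (fun t => (Matrix.SpecialLinearGroup.transvection hij t : GL (Fin n) ℂ))
      (.single i j 1) := by
  refine ⟨by simp, fun k l => ?_⟩
  simp only [Matrix.SpecialLinearGroup.coe_GL_coe_matrix,
    Matrix.SpecialLinearGroup.transvection_coe, Matrix.add_apply, Matrix.single_apply]
  refine .const_add _ ?_
  split_ifs
  · exact hasDerivAt_id _
  · exact hasDerivAt_const _ _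

theorem hasDerivAt_apply_matrix {c : ℂ → Matrix (Fin n) (Fin n) ℂ →ₗ[ℂ] ℂ}
    {c' : Matrix (Fin n) (Fin n) ℂ →ₗ[ℂ] ℂ} {M : ℂ → Matrix (Fin n) (Fin n) ℂ}
    {M' : Matrix (Fin n) (Fin n) ℂ} {s : ℂ} (hc : ∀ X, HasDerivAt (fun t => c t X) (c' X) s)
    (hM : ∀ i j, HasDerivAt (fun t => M t i j) (M' i j) s) :
    HasDerivAt (fun t => c t (M t)) (c' (M s) + c s M') s := by
  have expand (d : Matrix (Fin n) (Fin n) ℂ →ₗ[ℂ] ℂ) (X : Matrix (Fin n) (Fin n) ℂ) :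
      d X = ∑ i, ∑ j, X i j * d (.single i j 1) := by
    conv_lhs => rw [Matrix.matrix_eq_sum_single X]
    rw [map_sum]
    refine Finset.sum_congr rfl fun i _ => ?_
    rw [map_sum]
    refine Finset.sum_congr rfl fun j _ => ?_
    rw [← smul_eq_mul, ← map_smul, Matrix.smul_single, smul_eq_mul, mul_one]
  simp only [fun t => expand (c t) (M t)]
  rw [expand c', expand (c s), add_comm]
  simp only [← Finset.sum_add_distrib]
  exact .fun_sum fun i _ => .fun_sum fun j _ => (hM i j).mul (hc _)

end Velocities

section Differential

variable {n : ℕ} {V : Type*} [AddCommGroup V] [Module ℂ V]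
  {ρ : Representation ℂ (GL (Fin n) ℂ) V}

theorem IsRational.exists_hasDerivAt (hρ : IsRational ρ) (f : Module.Dual ℂ V) (v : V) :
    ∃ L : Matrix (Fin n) (Fin n) ℂ →ₗ[ℂ] ℂ, ∀ g A, HasVelocity g A →
      HasDerivAt (fun t => f (ρ (g t) v)) (L A) 0 := by
  obtain ⟨Q, N, hQ⟩ := hρ f v
  let entries (M : Matrix (Fin n) (Fin n) ℂ) (ij : Fin n × Fin n) : ℂ := M ij.1 ij.2
  let F (x : Fin n × Fin n → ℂ) : ℂ := MvPolynomial.eval x Q /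
    MvPolynomial.eval x (Matrix.mvPolynomialX (Fin n) (Fin n) ℂ).det ^ N
  have hdet (M : Matrix (Fin n) (Fin n) ℂ) :
      MvPolynomial.eval (entries M) (Matrix.mvPolynomialX (Fin n) (Fin n) ℂ).det = M.det :=
    Matrix.eval_det_mvPolynomialX _ _ _
  have hF : DifferentiableAt ℂ F (entries 1) := by
    have hpoly (p : MvPolynomial (Fin n × Fin n) ℂ) :
        DifferentiableAt ℂ (fun x => MvPolynomial.eval x p) (entries 1) :=
      (AnalyticOnNhd.eval_mvPolynomial p _ trivial).differentiableAt
    simp only [F, div_eq_mul_inv]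
    refine (hpoly Q).fun_mul (((hpoly _).fun_pow N).fun_inv ?_)
    rw [hdet, Matrix.det_one, one_pow]
    exact one_ne_zero
  refine ⟨(fderiv ℂ F (entries 1)).toLinearMap ∘ₗ
    { toFun := entries, map_add' := fun _ _ => rfl, map_smul' := fun _ _ => rfl },
    fun g A hg => ?_⟩
  have hcurve : HasDerivAt (fun t => entries (g t).val) (entries A) 0 :=
    hasDerivAt_pi.mpr fun ij => hg.hasDerivAt ij.1 ij.2
  have hcoeff : (fun t => f (ρ (g t) v)) = fun t => F (entries (g t).val) := by
    funext t
    rw [hQ, ← hdet]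
  have hF0 : HasFDerivAt F (fderiv ℂ F (entries 1)) (entries (g 0).val) := by
    rw [hg.map_zero]
    exact hF.hasFDerivAt
  rw [hcoeff]
  exact hF0.comp_hasDerivAt 0 hcurve

/-- `D` is the differential at the identity of the representation `ρ`. As no topology is given on
`V`, the derivatives of matrix coefficients along curves are prescribed instead. -/
def IsDifferential (ρ : Representation ℂ (GL (Fin n) ℂ) V)
    (D : Matrix (Fin n) (Fin n) ℂ → Module.End ℂ V) : Prop :=
  ∀ g A, HasVelocity g A → ∀ (f : Module.Dual ℂ V) (v : V),
    HasDerivAt (fun t => f (ρ (g t) v)) (f (D A v)) 0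

theorem IsRational.exists_isDifferential_linearMap [FiniteDimensional ℂ V] (hρ : IsRational ρ) :
    ∃ D : Matrix (Fin n) (Fin n) ℂ →ₗ[ℂ] Module.End ℂ V, IsDifferential ρ D := by
  set b := Module.finBasis ℂ V
  choose L hL using fun ij : _ × _ => hρ.exists_hasDerivAt (b.coord ij.1) (b ij.2)
  refine ⟨∑ ij, (L ij).smulRight (b.end ij), fun g A hg f v => ?_⟩
  have expand (T : Module.End ℂ V) : f (T v) = ∑ ij, b.end.coord ij T * f (b.end ij v) := by
    conv_lhs => rw [← b.end.sum_repr T]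
    simp [LinearMap.sum_apply]
  simp only [fun t => expand (ρ (g t)), coord_end_apply, LinearMap.sum_apply,
    LinearMap.smulRight_apply, LinearMap.smul_apply, map_sum, map_smul, smul_eq_mul]
  exact .fun_sum fun ij _ => (hL ij g A hg).mul_const _

variable {D : Matrix (Fin n) (Fin n) ℂ →ₗ[ℂ] Module.End ℂ V}

theorem IsDifferential.apply_mul_comm (hD : IsDifferential ρ D) (h : GL (Fin n) ℂ)
    (A : Matrix (Fin n) (Fin n) ℂ) : ρ h * D (A * h.val) = D (h.val * A) * ρ h := by
  ext v
  refine eq_of_forall_dual_eq (K := ℂ) fun f => ?_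
  obtain ⟨g, hg⟩ := exists_hasVelocity (A * h.val)
  have hconj := hD _ _ (hg.conj h) f (ρ h v)
  have hcoeff : (fun t => f (ρ (h * g t * h⁻¹) (ρ h v))) = fun t => (f ∘ₗ ρ h) (ρ (g t) v) := by
    funext t
    rw [← Module.End.mul_apply, ← map_mul, inv_mul_cancel_right, map_mul]
    rfl
  rw [hcoeff, ← mul_assoc, Units.mul_inv_cancel_right] at hconj
  exact (hD g _ hg (f ∘ₗ ρ h) v).unique hconj

/-- Differentiating `ρ g ∘ D (A g) = D (g A) ∘ ρ g` along a curve `g` with velocity `B` gives the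
bracket relation without ever differentiating an inverse. -/
theorem IsDifferential.map_mul_map (hD : IsDifferential ρ D) (B A : Matrix (Fin n) (Fin n) ℂ) :
    D B * D A + D (A * B) = D (B * A) + D A * D B := by
  ext v
  refine eq_of_forall_dual_eq (K := ℂ) fun f => ?_
  obtain ⟨g, hg⟩ := exists_hasVelocity B
  let ev (x : V) : Module.End ℂ V →ₗ[ℂ] V := LinearMap.applyₗ x
  have hleft := hasDerivAt_apply_matrix (c := fun t => (f ∘ₗ ρ (g t)) ∘ₗ ev v ∘ₗ D)
    (c' := (f ∘ₗ D B) ∘ₗ ev v ∘ₗ D) (M := fun t => A * (g t).val) (M' := A * B)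
    (fun X => hD g B hg f (D X v)) fun i j => by
      simp only [Matrix.mul_apply]
      exact .fun_sum fun k _ => (hg.hasDerivAt k j).const_mul _
  have hright := hasDerivAt_apply_matrix (c := fun t => f ∘ₗ ev (ρ (g t) v) ∘ₗ D)
    (c' := f ∘ₗ ev (D B v) ∘ₗ D) (M := fun t => (g t).val * A) (M' := B * A)
    (fun X => hD g B hg (f ∘ₗ D X) v) fun i j => by
      simp only [Matrix.mul_apply]
      exact .fun_sum fun k _ => (hg.hasDerivAt i k).mul_const _
  have hcoeff (t : ℂ) : f (ρ (g t) (D (A * (g t).val) v)) = f (D ((g t).val * A) (ρ (g t) v)) :=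
    congrArg f (LinearMap.congr_fun (hD.apply_mul_comm (g t) A) v)
  have heq := hleft.unique (hright.congr_of_eventuallyEq (.of_forall hcoeff))
  simpa [ev, hg.map_zero, add_comm] using heq

section Lie

attribute [local instance] LieRing.ofAssociativeRing

theorem IsRational.exists_isDifferential [FiniteDimensional ℂ V] (hρ : IsRational ρ) :
    ∃ φ : Matrix (Fin n) (Fin n) ℂ →ₗ⁅ℂ⁆ Module.End ℂ V, IsDifferential ρ φ := by
  obtain ⟨D, hD⟩ := hρ.exists_isDifferential_linearMap
  refine ⟨{ D with map_lie' := fun {B A} => ?_ }, hD⟩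
  change D (B * A - A * B) = D B * D A - D A * D B
  rw [map_sub, sub_eq_sub_iff_add_eq_add]
  exact (hD.map_mul_map B A).symm

end Lie

end Differential

section TorusRepresentations

variable {ι K V : Type*} [Fintype ι] [Field K] [AddCommGroup V] [Module K V]

theorem exists_finsupp_torusChar_sum [FiniteDimensional K V] {F : (ι → Kˣ) → Module.End K V}
    (hF : ∀ (f : Module.Dual K V) v, ∃ l : Laurent ι K, ∀ z, f (F z v) = torusEval z l) :
    ∃ P : (ι → ℤ) →₀ Module.End K V, ∀ z, F z = P.sum fun μ T => torusChar μ z • T := by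
  set b := Module.finBasis K V
  choose l hl using fun ij : _ × _ => hF (b.coord ij.1) (b ij.2)
  refine ⟨∑ ij, (l ij).coeff.mapRange (· • b.end ij) (zero_smul _ _), fun z => ?_⟩
  rw [← Finsupp.sum_finsetSum_index (fun _ => smul_zero _) fun _ _ _ => smul_add _ _ _,
    ← b.end.sum_repr (F z)]
  refine Finset.sum_congr rfl fun ij _ => ?_
  rw [← Module.Basis.coord_apply, coord_end_apply, hl, torusEval_eq_sum,
    Finsupp.sum_mapRange_index fun _ => smul_zero _, Finsupp.sum, Finset.sum_smul]
  simp only [smul_assoc, Finsupp.sum]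

variable {P : (ι → ℤ) →₀ Module.End K V} {τ : (ι → Kˣ) →* Module.End K V}

theorem sum_eq_one_of_torusChar_sum (hP : ∀ z, τ z = P.sum fun μ T => torusChar μ z • T) :
    (P.sum fun _ T => T) = 1 := by
  simpa using (hP 1).symm

variable [CharZero K]

theorem weightComponent_mul_apply (hP : ∀ z, τ z = P.sum fun μ T => torusChar μ z • T) (μ : ι → ℤ)
    (y : ι → Kˣ) : P μ * τ y = torusChar μ y • P μ := by
  have heq : P.mapRange (· * τ y) (zero_mul _) =
      .onFinset P.support (fun μ => torusChar μ y • P μ) (by simp +contextual) := by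
    refine finsupp_ext_of_torusChar (K := K) fun z => ?_
    rw [Finsupp.sum_mapRange_index (by simp), Finsupp.onFinset_sum _ (by simp)]
    have hmul := map_mul τ z y
    rw [hP (z * y), hP z, Finsupp.sum, Finsupp.sum, Finset.sum_mul] at hmul
    simpa [Finsupp.sum, mul_smul] using hmul.symm
  exact DFunLike.congr_fun heq μ

theorem apply_mul_weightComponent (hP : ∀ z, τ z = P.sum fun μ T => torusChar μ z • T) (μ : ι → ℤ)
    (y : ι → Kˣ) : τ y * P μ = torusChar μ y • P μ := by
  have heq : P.mapRange (τ y * ·) (mul_zero _) = P.mapRange (· * τ y) (zero_mul _) := by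
    refine finsupp_ext_of_torusChar (K := K) fun z => ?_
    rw [Finsupp.sum_mapRange_index (by simp), Finsupp.sum_mapRange_index (by simp)]
    have hcomm := (Commute.all y z).map τ
    rw [hP z, Finsupp.sum] at hcomm
    simpa [Finsupp.sum, Finset.mul_sum, Finset.sum_mul] using hcomm.eq
  rw [← weightComponent_mul_apply hP]
  exact DFunLike.congr_fun heq μ

end TorusRepresentations

section Weights

variable {n : ℕ} {V : Type*} [AddCommGroup V] [Module ℂ V]
  {ρ : Representation ℂ (GL (Fin n) ℂ) V}

theorem coe_torusElt (z : Fin n → ℂˣ) :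
    (torusElt z : Matrix (Fin n) (Fin n) ℂ) = .diagonal fun i => (z i : ℂ) := rfl

/-- The embedding of the diagonal torus into `GL_n(ℂ)` as a group homomorphism. -/
noncomputable def torusHom (n : ℕ) : (Fin n → ℂˣ) →* GL (Fin n) ℂ where
  toFun := torusElt
  map_one' := by
    ext : 1
    simp [coe_torusElt]
  map_mul' y z := by
    ext : 1
    simp [coe_torusElt]

theorem torusHom_apply (z : Fin n → ℂˣ) : torusHom n z = torusElt z := rfl

theorem IsRational.exists_laurent_coeff (hρ : IsRational ρ) (f : Module.Dual ℂ V) (v : V) :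
    ∃ l : Laurent (Fin n) ℂ, ∀ z, f (ρ (torusElt z) v) = torusEval z l := by
  obtain ⟨Q, N, hQ⟩ := hρ f v
  refine ⟨Q.aeval (fun ij => if ij.1 = ij.2 then laurentVar ij.1 else 0) *
    .single (fun _ => -(N : ℤ)) 1, fun z => ?_⟩
  have hentries : (fun ij : Fin n × Fin n => (torusElt z).val ij.1 ij.2) =
      fun ij => torusEval z (if ij.1 = ij.2 then laurentVar ij.1 else 0) := by
    funext ij
    rw [coe_torusElt, Matrix.diagonal_apply, apply_ite (torusEval z), map_zero]
    simp [laurentVar, torusEval_single, torusChar_single]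
  have hdet : (torusElt z).val.det ^ N = (torusChar (fun _ => -(N : ℤ)) z)⁻¹ := by
    rw [coe_torusElt, Matrix.det_diagonal, torusChar_apply, ← Finset.prod_pow,
      ← Finset.prod_inv_distrib]
    simp
  rw [hQ, hdet, div_inv_eq_mul, map_mul, torusEval_single, one_mul, hentries,
    MvPolynomial.comp_aeval_apply, ← MvPolynomial.coe_aeval_eq_eval, RingHom.coe_coe]

theorem hasVelocity_torusElt (i : Fin n) :
    HasVelocity (fun t => torusElt (Pi.mulSingle i (Units.mk0 _ (Complex.exp_ne_zero t))))
      (.single i i 1) := by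
  refine ⟨?_, fun k l => ?_⟩
  · simp only [Complex.exp_zero, Units.mk0_one, Pi.mulSingle_one]
    exact map_one (torusHom n)
  · simp only [coe_torusElt]
    rcases eq_or_ne k l with rfl | hkl
    · simp only [Matrix.diagonal_apply_eq]
      rcases eq_or_ne k i with rfl | hki
      · simpa using Complex.hasDerivAt_exp 0
      · simpa [hki, hki.symm] using hasDerivAt_const (0 : ℂ) (1 : ℂ)
    · have hil : ¬ (i = k ∧ i = l) := fun h => hkl (h.1.symm.trans h.2)
      simpa [hkl, hil] using hasDerivAt_const (0 : ℂ) (0 : ℂ)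

theorem IsDifferential.apply_single_self {D : Matrix (Fin n) (Fin n) ℂ → Module.End ℂ V}
    (hD : IsDifferential ρ D) {f : Module.Dual ℂ V} {x : V} {μ : Fin n → ℤ} {c : ℂ}
    (h : ∀ z, f (ρ (torusElt z) x) = torusChar μ z * c) (i : Fin n) :
    f (D (.single i i 1) x) = μ i * c := by
  refine (hD _ _ (hasVelocity_torusElt i) f x).unique ?_
  simp only [h, torusChar_mulSingle, Units.val_mk0, ← Complex.exp_int_mul]
  simpa using (((hasDerivAt_id (0 : ℂ)).const_mul (μ i : ℂ)).cexp).mul_const c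

attribute [local instance] LieRing.ofAssociativeRing

variable {φ : Matrix (Fin n) (Fin n) ℂ →ₗ⁅ℂ⁆ Module.End ℂ V}

theorem IsDifferential.isWeightDecomposition (hφ : IsDifferential ρ φ)
    {P : (Fin n → ℤ) →₀ Module.End ℂ V}
    (hP : ∀ z, ρ.comp (torusHom n) z = P.sum fun μ T => torusChar μ z • T) :
    IsWeightDecomposition φ P := by
  refine ⟨sum_eq_one_of_torusChar_sum hP, fun μ i => ?_, fun μ i => ?_⟩ <;>
    refine LinearMap.ext fun x => eq_of_forall_dual_eq (K := ℂ) fun f => ?_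
  · simpa using hφ.apply_single_self (x := P μ x) (c := f (P μ x)) (fun z => by
      simpa [torusHom_apply] using
        congrArg f (LinearMap.congr_fun (apply_mul_weightComponent hP μ z) x)) i
  · simpa using hφ.apply_single_self (f := f ∘ₗ P μ) (c := f (P μ x)) (fun z => by
      simpa [torusHom_apply] using
        congrArg f (LinearMap.congr_fun (weightComponent_mul_apply hP μ z) x)) i

theorem HasHighestWeight.exists_isHighestWeightVector (hφ : IsDifferential ρ φ) {w : Fin n → ℤ}
    (h : HasHighestWeight ρ w) : ∃ v, IsHighestWeightVector φ w v := by
  obtain ⟨v, hv, hb⟩ := h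
  refine ⟨v, hv, fun i => ?_, fun i j hij => ?_⟩ <;>
    refine eq_of_forall_dual_eq (K := ℂ) fun f => ?_
  · rw [map_smul, smul_eq_mul]
    refine hφ.apply_single_self (fun z => ?_) i
    rw [hb _ fun i j hji => by rw [coe_torusElt, Matrix.diagonal_apply_ne _ hji.ne'], map_smul]
    simp [coe_torusElt, torusChar_apply]
  · refine (hφ _ _ (hasVelocity_transvection hij.ne) f v).unique ?_
    have hfix (t : ℂ) :
        ρ (Matrix.SpecialLinearGroup.transvection hij.ne t : GL (Fin n) ℂ) v = v := by
      rw [hb]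
      · have hdiag (k : Fin n) : ¬ (i = k ∧ j = k) := fun h => hij.ne (h.1.trans h.2.symm)
        simp [Matrix.SpecialLinearGroup.transvection_coe, hdiag]
      · intro k l hlk
        have hkl : ¬ (i = k ∧ j = l) := fun h => (h.1 ▸ h.2 ▸ hlk).not_gt hij
        simp [Matrix.SpecialLinearGroup.transvection_coe, hkl, hlk.ne']
    simpa [hfix] using hasDerivAt_const (0 : ℂ) (f v)

theorem torusEval_formalTrace_one {P : (Fin n → ℤ) →₀ Module.End ℂ V}
    (hP : ∀ z, ρ.comp (torusHom n) z = P.sum fun μ T => torusChar μ z • T) (z : Fin n → ℂˣ) :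
    torusEval z (formalTrace P 1) = ρ.character (torusElt z) := by
  have hz : ρ.character (torusElt z) = LinearMap.trace ℂ V (P.sum fun μ T => torusChar μ z • T) :=
    congrArg (LinearMap.trace ℂ V) (hP z)
  rw [hz, map_finsuppSum, torusEval_eq_sum]
  refine (Finsupp.sum_mapRange_index (hf := by simp) fun μ => smul_zero (torusChar μ z)).trans
    (Finsupp.sum_congr fun μ _ => ?_)
  rw [mul_one, map_smul]

theorem exists_conj_torusElt_comp_perm (σ : Equiv.Perm (Fin n)) (z : Fin n → ℂˣ) :
    ∃ g : GL (Fin n) ℂ, torusElt (z ∘ σ) = g * torusElt z * g⁻¹ := by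
  have hdet : (σ.permMatrix ℂ).det ≠ 0 := by
    rw [Matrix.det_permutation]
    exact_mod_cast (Equiv.Perm.sign σ).ne_zero
  refine ⟨.mkOfDetNeZero (σ.permMatrix ℂ) hdet, ?_⟩
  rw [eq_mul_inv_iff_mul_eq]
  apply Units.ext
  change Matrix.diagonal _ * σ.permMatrix ℂ = σ.permMatrix ℂ * Matrix.diagonal _
  ext i j
  rw [Matrix.diagonal_mul, Matrix.mul_diagonal]
  rcases eq_or_ne (σ i) j with rfl | h
  · simp [mul_comm]
  · simp [Equiv.Perm.permMatrix, PEquiv.toMatrix_apply, h]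

theorem permVars_formalTrace_one {P : (Fin n → ℤ) →₀ Module.End ℂ V}
    (hP : ∀ z, ρ.comp (torusHom n) z = P.sum fun μ T => torusChar μ z • T)
    (σ : Equiv.Perm (Fin n)) : permVars σ (formalTrace P 1) = formalTrace P 1 := by
  refine torusEval_ext fun z => ?_
  obtain ⟨g, hg⟩ := exists_conj_torusElt_comp_perm σ z
  rw [torusEval_permVars, torusEval_formalTrace_one hP, torusEval_formalTrace_one hP, hg,
    Representation.char_conj]

end Weights

section Stability

theorem eq_zero_of_derivative_eq {α R : Type*} [Ring R] [IsDomain R] [CharZero R] {s : Set α}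
    {e : α → α} (he : Set.MapsTo e s s) {q : α → Polynomial R}
    (hq : ∀ y ∈ s, (q y).derivative = q (e y)) (h0 : ∀ y ∈ s, (q y).eval 0 = 0) {y : α}
    (hy : y ∈ s) : q y = 0 := by
  ext k
  rw [Polynomial.coeff_zero]
  induction k generalizing y with
  | zero => rw [Polynomial.coeff_zero_eq_eval_zero, h0 y hy]
  | succ k ih =>
    have hk := congrArg (Polynomial.coeff · k) (hq y hy)
    simp only [Polynomial.coeff_derivative, ih (he hy)] at hk
    exact (mul_eq_zero.mp hk).resolve_right (Nat.cast_add_one_ne_zero k)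

variable {n : ℕ} {V : Type*} [AddCommGroup V] [Module ℂ V] {ρ : Representation ℂ (GL (Fin n) ℂ) V}

theorem IsRational.exists_polynomial_transvection (hρ : IsRational ρ) {i j : Fin n} (hij : i ≠ j)
    (f : Module.Dual ℂ V) (v : V) : ∃ q : Polynomial ℂ, ∀ t,
      f (ρ (Matrix.SpecialLinearGroup.transvection hij t : GL (Fin n) ℂ) v) = q.eval t := by
  obtain ⟨Q, N, hQ⟩ := hρ f v
  refine ⟨Q.aeval fun kl => .C ((1 : Matrix (Fin n) (Fin n) ℂ) kl.1 kl.2) +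
    if i = kl.1 ∧ j = kl.2 then .X else 0, fun t => ?_⟩
  rw [hQ, Matrix.SpecialLinearGroup.coe_GL_coe_matrix, Matrix.SpecialLinearGroup.det_coe, one_pow,
    div_one, ← Polynomial.coe_aeval_eq_eval, ← MvPolynomial.coe_aeval_eq_eval,
    MvPolynomial.comp_aeval_apply, RingHom.coe_coe]
  congr 2 with kl
  rw [Matrix.SpecialLinearGroup.transvection_coe, Matrix.add_apply, Matrix.single_apply]
  split_ifs <;> simp

variable {D : Matrix (Fin n) (Fin n) ℂ → Module.End ℂ V} {W : Submodule ℂ V}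

theorem IsDifferential.derivative_eq (hD : IsDifferential ρ D) {i j : Fin n} (hij : i ≠ j)
    {f : Module.Dual ℂ V} {q : V → Polynomial ℂ}
    (hq : ∀ y t, f (ρ (Matrix.SpecialLinearGroup.transvection hij t : GL (Fin n) ℂ) y) =
      (q y).eval t) (y : V) : (q y).derivative = q (D (.single i j 1) y) := by
  refine Polynomial.funext fun t => ?_
  have hadd (u : ℂ) : (f ∘ₗ ρ (Matrix.SpecialLinearGroup.transvection hij t : GL (Fin n) ℂ))
      (ρ (Matrix.SpecialLinearGroup.transvection hij u : GL (Fin n) ℂ) y) =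
        (q y).eval (t + u) := by
    rw [← hq, Matrix.SpecialLinearGroup.transvection_add, map_mul, map_mul]
    rfl
  have htranslate := hD _ _ (hasVelocity_transvection hij)
    (f ∘ₗ ρ (Matrix.SpecialLinearGroup.transvection hij t : GL (Fin n) ℂ)) y
  simp only [hadd] at htranslate
  rw [← hq]
  have hshift : HasDerivAt (fun u => (q y).eval (t + u)) ((q y).derivative.eval t) 0 :=
    HasDerivAt.comp_const_add t 0 (by simpa only [add_zero] using (q y).hasDerivAt t)
  exact hshift.unique htranslate

theorem IsDifferential.le_comap_transvection (hD : IsDifferential ρ D) (hρ : IsRational ρ)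
    {i j : Fin n} (hij : i ≠ j) (hW : W ≤ W.comap (D (.single i j 1))) (s : ℂ) :
    W ≤ W.comap (ρ (Matrix.SpecialLinearGroup.transvection hij s : GL (Fin n) ℂ)) := by
  intro x hx
  by_contra hcon
  obtain ⟨f, hf, hfW⟩ := Submodule.exists_le_ker_of_notMem (Submodule.mem_comap.not.mp hcon)
  choose q hq using hρ.exists_polynomial_transvection hij f
  have hzero : q x = 0 := by
    refine eq_zero_of_derivative_eq (s := W) (fun y hy => hW hy)
      (fun y _ => hD.derivative_eq hij hq y) (fun y hy => ?_) hx
    rw [← hq, Matrix.SpecialLinearGroup.transvection_coeff_zero, map_one, map_one]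
    exact hfW hy
  exact hf (by rw [hq, hzero, Polynomial.eval_zero])

theorem IsDifferential.le_comap (hD : IsDifferential ρ D) (hρ : IsRational ρ)
    (htorus : ∀ z, W ≤ W.comap (ρ (torusElt z)))
    (hW : ∀ i j, W ≤ W.comap (D (.single i j 1))) (g : GL (Fin n) ℂ) : W ≤ W.comap (ρ g) := by
  suffices ∀ M : Matrix (Fin n) (Fin n) ℂ, M.det ≠ 0 → ∀ g : GL (Fin n) ℂ, g.val = M →
      W ≤ W.comap (ρ g) from this g.val g.det_ne_zero g rfl
  intro M hM
  refine Matrix.diagonal_transvection_induction_of_det_ne_zero (fun M => ∀ g : GL (Fin n) ℂ,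
    g.val = M → W ≤ W.comap (ρ g)) M hM (fun d hd g hg => ?_) (fun t g hg => ?_)
    fun A B hA hB ihA ihB g hg => ?_
  · rw [Matrix.det_diagonal, Finset.prod_ne_zero_iff] at hd
    have hgd : g = torusElt fun i => Units.mk0 (d i) (hd i (Finset.mem_univ i)) := Units.ext hg
    exact hgd ▸ htorus _
  · have hgt : g = (Matrix.SpecialLinearGroup.transvection t.hij t.c : GL (Fin n) ℂ) := Units.ext hg
    exact hgt ▸ hD.le_comap_transvection hρ t.hij (hW _ _) _
  · have hgAB : g = .mkOfDetNeZero A hA * .mkOfDetNeZero B hB := Units.ext hg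
    rw [hgAB, map_mul]
    exact fun x hx => ihA _ rfl (ihB _ rfl hx)

end Stability

theorem eq_top_of_le_comap {K G V : Type*} [Field K] [Monoid G] [AddCommGroup V] [Module K V]
    {ρ : Representation K G V} (hρ : ρ.IsIrreducible) {W : Submodule K V}
    (hW : ∀ g, W ≤ W.comap (ρ g)) (hbot : W ≠ ⊥) : W = ⊤ := by
  let S : Subrepresentation ρ := ⟨W, hW⟩
  rcases IsSimpleOrder.eq_bot_or_eq_top S with hS | hS
  · exact absurd (congrArg Subrepresentation.toSubmodule hS) hbot
  · exact congrArg Subrepresentation.toSubmodule hS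

section Characters

attribute [local instance] LieRing.ofAssociativeRing

variable {n : ℕ} {V : Type*} [AddCommGroup V] [Module ℂ V]
  {ρ : Representation ℂ (GL (Fin n) ℂ) V} {φ : Matrix (Fin n) (Fin n) ℂ →ₗ⁅ℂ⁆ Module.End ℂ V}

theorem IsDifferential.lowerSpan_le_comap_torusElt (hφ : IsDifferential ρ φ)
    {P : (Fin n → ℤ) →₀ Module.End ℂ V}
    (hP : ∀ z, ρ.comp (torusHom n) z = P.sum fun μ T => torusChar μ z • T) {w : Fin n → ℤ} {v : V}
    (hv : IsWeightVector φ w v) (z : Fin n → ℂˣ) :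
    lowerSpan φ w v ≤ (lowerSpan φ w v).comap (ρ (torusElt z)) := by
  refine Submodule.span_le.mpr fun x ⟨μ, hx⟩ => ?_
  have hPφ := hφ.isWeightDecomposition hP
  have hμ : P μ x = x := hPφ.apply_self (hx.isWeightVector hv)
  have hweight : ρ (torusElt z) x = torusChar μ z • x := by
    conv_lhs => rw [← hμ]
    conv_rhs => rw [← hμ]
    exact LinearMap.congr_fun (apply_mul_weightComponent hP μ z) x
  rw [SetLike.mem_coe, Submodule.mem_comap, hweight]
  exact Submodule.smul_mem _ _ hx.mem_lowerSpan

theorem IsDifferential.lowerSpan_eq_top (hφ : IsDifferential ρ φ) (hρ : IsRational ρ)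
    (hirr : ρ.IsIrreducible) {P : (Fin n → ℤ) →₀ Module.End ℂ V}
    (hP : ∀ z, ρ.comp (torusHom n) z = P.sum fun μ T => torusChar μ z • T) {w : Fin n → ℤ} {v : V}
    (hv : IsHighestWeightVector φ w v) : lowerSpan φ w v = ⊤ :=
  eq_top_of_le_comap hirr (hφ.le_comap hρ (hφ.lowerSpan_le_comap_torusElt hP hv.isWeightVector)
    fun _ _ => hv.lowerSpan_le_comap_map _)
    (Submodule.ne_bot_iff _ |>.mpr ⟨v, IsLowering.base.mem_lowerSpan, hv.ne_zero⟩)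

theorem IsIrrepOfHighestWeight.character_torusElt {ℓ : ℕ} {p : Fin (ℓ + 1) → ℤ} (hp : Monotone p)
    {ρ : Representation ℂ (GL (Fin (ℓ + 1)) ℂ) V}
    (h : IsIrrepOfHighestWeight ρ (p ∘ Fin.rev)) (z : Fin (ℓ + 1) → ℂˣ) :
    ρ.character (torusElt z) = gzChar ℓ p z := by
  have := h.finite
  obtain ⟨φ, hφ⟩ := h.rational.exists_isDifferential
  obtain ⟨v, hv⟩ := h.highestWeight.exists_isHighestWeightVector hφ
  obtain ⟨P, hP⟩ := exists_finsupp_torusChar_sum (F := ρ.comp (torusHom (ℓ + 1)))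
    h.rational.exists_laurent_coeff
  have htop := hφ.lowerSpan_eq_top h.rational h.irreducible hP hv
  have hformal : formalTrace P 1 = gzLaurent ℂ ℓ p := by
    refine mul_left_cancel₀ (alternant_delta_ne_zero (K := ℂ) (n := ℓ + 1)) ?_
    rw [alternant_delta_mul_gzLaurent hp]
    exact (hφ.isWeightDecomposition hP).alternant_delta_mul_formalTrace_one hp hv htop
      (permVars_formalTrace_one hP)
  rw [← torusEval_formalTrace_one hP, hformal, gzChar_eq_torusEval hp]

end Characters

/-! ### Existence of irreducible representations -/

section OrbitSpan

variable {K G V : Type*} [CommSemiring K] [Monoid G] [AddCommMonoid V] [Module K V]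

/-- The subrepresentation generated by a vector: the span of its orbit. -/
def orbitSpan (ρ : Representation K G V) (v : V) : Subrepresentation ρ where
  toSubmodule := .span K (.range (ρ · v))
  apply_mem_toSubmodule g := by
    suffices Submodule.span K (.range (ρ · v)) ≤
        (Submodule.span K (.range (ρ · v))).comap (ρ g) from fun _ hx => this hx
    refine Submodule.span_le.mpr ?_
    rintro _ ⟨h, rfl⟩
    exact Submodule.subset_span ⟨g * h, by simp only [map_mul, Module.End.mul_apply]⟩

theorem self_mem_orbitSpan (ρ : Representation K G V) (v : V) : v ∈ (orbitSpan ρ v).toSubmodule :=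
  Submodule.subset_span ⟨1, by simp only [map_one, Module.End.one_apply]⟩

theorem orbitSpan_toSubmodule_le {ρ : Representation K G V} {v : V} {N : Subrepresentation ρ}
    (hv : v ∈ N.toSubmodule) : (orbitSpan ρ v).toSubmodule ≤ N.toSubmodule :=
  Submodule.span_le.mpr (Set.range_subset_iff.mpr fun g => N.apply_mem_toSubmodule g hv)

theorem orbitSpan_orbitSpan (ρ : Representation K G V) (v : V) :
    orbitSpan (orbitSpan ρ v).toRepresentation ⟨v, self_mem_orbitSpan ρ v⟩ = ⊤ := by
  refine Subrepresentation.toSubmodule_injective ?_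
  refine Eq.trans (congrArg (Submodule.span K) ?_)
    (Submodule.span_span_coe_preimage (R := K) (s := .range (ρ · v)))
  ext x
  simp only [Set.mem_range, Subtype.ext_iff]
  rfl

end OrbitSpan

section IrreducibleQuotient

variable {K G V : Type*} [Field K] [Monoid G] [AddCommGroup V] [Module K V]
  {ρ : Representation K G V}

instance [IsNoetherian K V] : IsCoatomic (Subrepresentation ρ) :=
  have : WellFoundedGT (Subrepresentation ρ) :=
    StrictMono.wellFoundedGT (f := Subrepresentation.toSubmodule) fun _ _ h => h
  isCoatomic_of_orderTop_gt_wellFounded wellFounded_gt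

theorem isIrreducible_quotient {N : Subrepresentation ρ} (hN : IsCoatom N) :
    (ρ.quotient N.toSubmodule N.apply_mem_toSubmodule).IsIrreducible where
  exists_pair_ne := by
    have hne : N.toSubmodule ≠ ⊤ := fun h => hN.1 (Subrepresentation.toSubmodule_injective h)
    have := Submodule.Quotient.nontrivial_iff.mpr hne
    exact ⟨⊥, ⊤, fun h => bot_ne_top (congrArg Subrepresentation.toSubmodule h)⟩
  eq_bot_or_eq_top S := by
    let T : Subrepresentation ρ :=
      ⟨S.toSubmodule.comap N.toSubmodule.mkQ, fun g _ hx => S.apply_mem_toSubmodule g hx⟩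
    have hS : S.toSubmodule = T.toSubmodule.map N.toSubmodule.mkQ :=
      (Submodule.map_comap_eq_of_surjective N.toSubmodule.mkQ_surjective _).symm
    have hNT : N ≤ T := N.toSubmodule.le_comap_mkQ S.toSubmodule
    refine (hN.le_iff.mp hNT).symm.imp (fun hT => ?_) fun hT => ?_
    · refine Subrepresentation.toSubmodule_injective (hS.trans ?_)
      rw [hT]
      exact Submodule.mkQ_map_self _
    · refine Subrepresentation.toSubmodule_injective (hS.trans ?_)
      rw [hT]
      exact (Submodule.map_top _).trans (Submodule.range_mkQ _)

end IrreducibleQuotient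

section RepresentativeFunctions

variable {K G : Type*} [CommSemiring K] [Monoid G]

/-- The representation of a monoid on the functions on it by right translation of the argument. -/
def rightRegular (K G : Type*) [CommSemiring K] [Monoid G] : Representation K G (G → K) where
  toFun g := LinearMap.funLeft K K (· * g)
  map_one' := LinearMap.ext fun f => funext fun x => congrArg f (mul_one x)
  map_mul' g h := LinearMap.ext fun f => funext fun x => congrArg f (mul_assoc x g h).symm

@[simp]
theorem rightRegular_apply (g x : G) (f : G → K) : rightRegular K G g f x = f (x * g) := rfl

/-- The representative functions relative to an algebra `A` of functions: those whose right
translates `f (· * g)` are combinations of finitely many functions with coefficients that are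
functions of `g` in `A`. -/
def representativeFun (A : Subalgebra K (G → K)) : Subalgebra K (G → K) where
  carrier := {f | ∃ (ι : Type) (_ : Fintype ι) (a b : ι → G → K),
    (∀ k, b k ∈ A) ∧ ∀ g, rightRegular K G g f = ∑ k, b k g • a k}
  mul_mem' := by
    rintro f h ⟨ι, _, a, b, hb, hf⟩ ⟨κ, _, c, d, hd, hh⟩
    refine ⟨ι × κ, inferInstance, fun k => a k.1 * c k.2, fun k => b k.1 * d k.2,
      fun k => A.mul_mem (hb _) (hd _), fun g => ?_⟩
    change rightRegular K G g f * rightRegular K G g h = _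
    simp only [hf, hh, Finset.sum_mul_sum, Fintype.sum_prod_type, Pi.mul_apply, smul_mul_smul_comm]
  add_mem' := by
    rintro f h ⟨ι, _, a, b, hb, hf⟩ ⟨κ, _, c, d, hd, hh⟩
    refine ⟨ι ⊕ κ, inferInstance, Sum.elim a c, Sum.elim b d, Sum.rec hb hd, fun g => ?_⟩
    rw [map_add, hf, hh, Fintype.sum_sum_type]
    rfl
  algebraMap_mem' r := ⟨Unit, inferInstance, fun _ => algebraMap K _ r, fun _ => 1,
    fun _ => A.one_mem, fun g => by ext x; simp⟩

theorem mem_representativeFun_of_mul {A : Subalgebra K (G → K)} {f b : G → K} (hb : b ∈ A)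
    (h : ∀ x g, f (x * g) = f x * b g) : f ∈ representativeFun A :=
  ⟨Unit, inferInstance, fun _ => f, fun _ => b, fun _ => hb, fun g => by ext x; simp [h, mul_comm]⟩

theorem dual_rightRegular_mem {A : Subalgebra K (G → K)}
    (hA : ∀ b ∈ A, ∀ c, rightRegular K G c b ∈ A) {f v : G → K} (hf : f ∈ representativeFun A)
    (hv : v ∈ (orbitSpan (rightRegular K G) f).toSubmodule) (φ : Module.Dual K (G → K)) :
    (fun g => φ (rightRegular K G g v)) ∈ A := by
  obtain ⟨ι, _, a, b, hb, hab⟩ := hf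
  suffices (orbitSpan (rightRegular K G) f).toSubmodule ≤
      (Subalgebra.toSubmodule A).comap (.pi fun g => φ ∘ₗ rightRegular K G g) from this hv
  refine Submodule.span_le.mpr (Set.range_subset_iff.mpr fun c => ?_)
  have hexpand : LinearMap.pi (fun g => φ ∘ₗ rightRegular K G g) (rightRegular K G c f) =
      ∑ k, φ (a k) • rightRegular K G c (b k) := by
    ext g
    rw [LinearMap.pi_apply, LinearMap.comp_apply, ← Module.End.mul_apply, ← map_mul, hab, map_sum,
      Finset.sum_apply]
    exact Finset.sum_congr rfl fun k _ => by
      rw [map_smul, Pi.smul_apply, rightRegular_apply, smul_eq_mul, smul_eq_mul, mul_comm]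
  rw [SetLike.mem_coe, Submodule.mem_comap, hexpand]
  exact A.sum_mem fun k _ => A.smul_mem (hA _ (hb k) c) _

end RepresentativeFunctions

theorem finiteDimensional_orbitSpan_rightRegular {K G : Type*} [Field K] [Monoid G]
    {A : Subalgebra K (G → K)} {f : G → K} (hf : f ∈ representativeFun A) :
    FiniteDimensional K (orbitSpan (rightRegular K G) f).toSubmodule := by
  obtain ⟨ι, _, a, b, _, hab⟩ := hf
  have := FiniteDimensional.span_of_finite K (Set.finite_range a)
  refine Submodule.finiteDimensional_of_le
    (Submodule.span_le.mpr (Set.range_subset_iff.mpr fun g => ?_) : _ ≤ Submodule.span K (.range a))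
  rw [hab]
  exact Submodule.sum_mem _ fun k _ => Submodule.smul_mem _ _ (Submodule.subset_span ⟨k, rfl⟩)

section RegularFunctions

variable {m K : Type*} [Fintype m] [DecidableEq m] [Field K]

theorem eval_det_coe (g : GL m K) : MvPolynomial.eval (fun ij => g.val ij.1 ij.2)
    (Matrix.mvPolynomialX m m K).det = g.val.det :=
  Matrix.eval_det_mvPolynomialX _ _ _

/-- The regular functions on the general linear group: polynomials in the matrix entries divided by
a power of the determinant. -/
def regularFun (m K : Type*) [Fintype m] [DecidableEq m] [Field K] : Subalgebra K (GL m K → K) where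
  carrier := {b | ∃ (Q : MvPolynomial (m × m) K) (N : ℕ), ∀ g : GL m K,
    b g = MvPolynomial.eval (fun ij => g.val ij.1 ij.2) Q / g.val.det ^ N}
  mul_mem' := by
    rintro a b ⟨Q, N, hQ⟩ ⟨R, M, hR⟩
    exact ⟨Q * R, N + M, fun g => by
      rw [Pi.mul_apply, hQ, hR, map_mul, pow_add, div_mul_div_comm]⟩
  add_mem' := by
    rintro a b ⟨Q, N, hQ⟩ ⟨R, M, hR⟩
    refine ⟨Q * (Matrix.mvPolynomialX m m K).det ^ M + R * (Matrix.mvPolynomialX m m K).det ^ N,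
      N + M, fun g => ?_⟩
    have hg := g.det_ne_zero
    rw [Pi.add_apply, hQ, hR, map_add, map_mul, map_mul, map_pow, map_pow, eval_det_coe, pow_add]
    field_simp
  algebraMap_mem' c := ⟨.C c, 0, fun g => by simp⟩

theorem entry_mem_regularFun (i j : m) : (fun g : GL m K => g.val i j) ∈ regularFun m K :=
  ⟨.X (i, j), 0, fun g => by simp⟩

theorem det_zpow_mem_regularFun (k : ℤ) : (fun g : GL m K => g.val.det ^ k) ∈ regularFun m K := by
  obtain ⟨N, rfl | rfl⟩ := k.eq_nat_or_neg
  · exact ⟨(Matrix.mvPolynomialX m m K).det ^ N, 0, fun g => by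
      simp only [map_pow, eval_det_coe, pow_zero, div_one, zpow_natCast]⟩
  · exact ⟨1, N, fun g => by simp⟩

theorem rightRegular_mem_regularFun {b : GL m K → K} (hb : b ∈ regularFun m K) (c : GL m K) :
    rightRegular K (GL m K) c b ∈ regularFun m K := by
  obtain ⟨Q, N, hQ⟩ := hb
  refine ⟨.C (c.val.det ^ N)⁻¹ *
    Q.bind₁ fun ij => ∑ k, .X (ij.1, k) * .C (c.val k ij.2), N, fun g => ?_⟩
  rw [rightRegular_apply, hQ, Units.val_mul, Matrix.det_mul, mul_pow, map_mul, MvPolynomial.eval_C,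
    ← MvPolynomial.coe_aeval_eq_eval, ← MvPolynomial.coe_aeval_eq_eval, RingHom.coe_coe,
    RingHom.coe_coe, MvPolynomial.aeval_bind₁]
  simp only [map_sum, map_mul, MvPolynomial.aeval_X, MvPolynomial.aeval_C, Matrix.mul_apply]
  rw [div_mul_eq_div_div_swap, div_eq_inv_mul (MvPolynomial.aeval _ Q)]
  rfl

theorem entry_mem_representativeFun (i j : m) :
    (fun g : GL m K => g.val i j) ∈ representativeFun (regularFun m K) :=
  ⟨Fin (Fintype.card m), inferInstance, fun k g => g.val i ((Fintype.equivFin m).symm k),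
    fun k g => g.val ((Fintype.equivFin m).symm k) j, fun k => entry_mem_regularFun _ j,
    fun g => by
      ext x
      simp only [rightRegular_apply, Units.val_mul, Matrix.mul_apply, Finset.sum_apply,
        Pi.smul_apply, smul_eq_mul, mul_comm (g.val _ j)]
      exact ((Fintype.equivFin m).symm.sum_comp fun k => x.val i k * g.val k j).symm⟩

end RegularFunctions

section Rational

variable {n : ℕ}

theorem isRational_orbitSpan_rightRegular {f : GL (Fin n) ℂ → ℂ}
    (hf : f ∈ representativeFun (regularFun (Fin n) ℂ)) :
    IsRational (orbitSpan (rightRegular ℂ (GL (Fin n) ℂ)) f).toRepresentation := by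
  rintro φ ⟨v, hv⟩
  obtain ⟨ψ, rfl⟩ := LinearMap.exists_extend φ
  exact dual_rightRegular_mem (fun _ hb c => rightRegular_mem_regularFun hb c) hf hv ψ

variable {V : Type*} [AddCommGroup V] [Module ℂ V] {ρ : Representation ℂ (GL (Fin n) ℂ) V}

theorem IsRational.quotient (hρ : IsRational ρ) (N : Subrepresentation ρ) :
    IsRational (ρ.quotient N.toSubmodule N.apply_mem_toSubmodule) := by
  intro f x
  obtain ⟨x, rfl⟩ := N.toSubmodule.mkQ_surjective x
  exact hρ (f ∘ₗ N.toSubmodule.mkQ) x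

theorem exists_isIrrepOfHighestWeight_quotient [FiniteDimensional ℂ V] (hρ : IsRational ρ)
    {w : Fin n → ℤ} {v : V} (hv0 : v ≠ 0) (hspan : orbitSpan ρ v = ⊤)
    (hv : ∀ b : GL (Fin n) ℂ, b.val.IsUpperTriangular → ρ b v = (∏ i, b.val i i ^ w i) • v) :
    ∃ N : Subrepresentation ρ,
      IsIrrepOfHighestWeight (ρ.quotient N.toSubmodule N.apply_mem_toSubmodule) w := by
  have hne : (⊥ : Subrepresentation ρ) ≠ ⊤ := fun h =>
    hv0 ((Submodule.mem_bot ℂ).mp (h ▸ Submodule.mem_top : v ∈ (⊥ : Subrepresentation ρ)))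
  obtain ⟨N, hN, -⟩ := (eq_top_or_exists_le_coatom (⊥ : Subrepresentation ρ)).resolve_left hne
  have hvN : v ∉ N.toSubmodule := fun h => hN.1 (top_le_iff.mp (hspan ▸ orbitSpan_toSubmodule_le h))
  exact ⟨N, inferInstance, hρ.quotient N, isIrreducible_quotient hN, N.toSubmodule.mkQ v,
    (Submodule.Quotient.mk_eq_zero _).not.mpr hvN, fun b hb =>
      (congrArg N.toSubmodule.mkQ (hv b fun i j => hb i j)).trans (map_smul _ _ _)⟩

end Rational

section LeadingMinors

variable {m R : Type*} [LinearOrder m] [Fintype m] [CommRing R]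

/-- The leading principal minor of a matrix with rows and columns up to and including `r`. -/
def leadingMinor (r : m) (M : Matrix m m R) : R := (M.toSquareBlockProp (· ≤ r)).det

theorem leadingMinor_one (r : m) : leadingMinor r (1 : Matrix m m R) = 1 := by
  rw [leadingMinor, show (1 : Matrix m m R).toSquareBlockProp (· ≤ r) = 1 from
    Matrix.toBlock_one_self _, Matrix.det_one]

theorem leadingMinor_of_isUpperTriangular (r : m) {b : Matrix m m R} (hb : b.IsUpperTriangular) :
    leadingMinor r b = ∏ i with i ≤ r, b i i := by
  have hblock : (b.toSquareBlockProp (· ≤ r)).IsUpperTriangular := fun i j hij => hb hij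
  rw [leadingMinor, Matrix.det_of_isUpperTriangular hblock]
  exact (Finset.prod_subtype _ (by simp) fun k => b k k).symm

theorem leadingMinor_mul (r : m) (M : Matrix m m R) {b : Matrix m m R} (hb : b.IsUpperTriangular) :
    leadingMinor r (M * b) = leadingMinor r M * leadingMinor r b := by
  have hzero : b.toBlock (¬ · ≤ r) (· ≤ r) = 0 := by
    ext i j
    exact hb (j.2.trans_lt (not_le.mp i.2))
  rw [leadingMinor, leadingMinor, leadingMinor, ← Matrix.det_mul]
  exact congrArg Matrix.det ((Matrix.toBlock_mul_eq_add _ (· ≤ r) _ M b).trans (by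
    rw [hzero, Matrix.mul_zero, add_zero]; rfl))

theorem leadingMinor_mem_representativeFun {K : Type*} [Field K] (r : m) :
    (fun g : GL m K => leadingMinor r g.val) ∈ representativeFun (regularFun m K) := by
  have hdet : (fun g : GL m K => leadingMinor r g.val) =
      ∑ σ : Equiv.Perm {i // i ≤ r}, Equiv.Perm.sign σ •
        ∏ i : {i // i ≤ r}, fun g : GL m K => g.val (σ i) i := by
    ext g
    rw [leadingMinor, Matrix.det_apply, Finset.sum_apply]
    exact Finset.sum_congr rfl fun σ _ => by rw [Pi.smul_apply, Finset.prod_apply]; rfl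
  rw [hdet]
  exact Subalgebra.sum_mem _ fun σ _ => Subalgebra.zsmul_mem _
    (Subalgebra.prod_mem _ fun i _ => entry_mem_representativeFun _ _) _

end LeadingMinors

theorem sum_castSucc_sub_succ {ℓ : ℕ} {M : Type*} [AddCommGroup M] (w : Fin (ℓ + 1) → M)
    (i : Fin (ℓ + 1)) :
    (∑ r : Fin ℓ, if i ≤ r.castSucc then w r.castSucc - w r.succ else 0) + w (Fin.last ℓ) =
      w i := by
  induction ℓ with
  | zero => rw [Fin.fin_one_eq_zero i]; simp
  | succ ℓ ih =>
    rw [Fin.sum_univ_castSucc]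
    induction i using Fin.lastCases with
    | last => simp [Fin.last_le_iff]
    | cast i =>
      rw [if_pos (Fin.castSucc_le_castSucc_iff.mpr (Fin.le_last i)), ← ih (fun j => w j.castSucc) i]
      simp only [Fin.castSucc_le_castSucc_iff, Fin.succ_castSucc, Fin.succ_last]
      abel

theorem prod_zpow_eq_of_antitone {ℓ : ℕ} {K : Type*} [CommGroupWithZero K] {w : Fin (ℓ + 1) → ℤ}
    (hw : Antitone w) {t : Fin (ℓ + 1) → K} (ht : ∀ i, t i ≠ 0) :
    ∏ i, t i ^ w i =
      (∏ r : Fin ℓ, (∏ i with i ≤ r.castSucc, t i) ^ (w r.castSucc - w r.succ).toNat) *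
        (∏ i, t i) ^ w (Fin.last ℓ) := by
  simp only [Finset.prod_filter, ← Finset.prod_zpow, ← Finset.prod_pow]
  rw [Finset.prod_comm, ← Finset.prod_mul_distrib]
  refine Finset.prod_congr rfl fun i _ => ?_
  conv_lhs => rw [← sum_castSucc_sub_succ w i, zpow_add₀ (ht i), zpow_sum (ht i)]
  congr 1
  refine Finset.prod_congr rfl fun r _ => ?_
  split_ifs
  · rw [← zpow_natCast, Int.toNat_of_nonneg (sub_nonneg.mpr (hw (Fin.castSucc_le_succ r)))]
  · rw [zpow_zero, one_pow]

section HighestWeightFunction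

variable {ℓ : ℕ} {K : Type*} [Field K]

/-- The product of powers of leading minors that has weight `w` under right translation by upper
triangular matrices, for antitone `w`. -/
def highestWeightFun (w : Fin (ℓ + 1) → ℤ) (g : GL (Fin (ℓ + 1)) K) : K :=
  (∏ r : Fin ℓ, leadingMinor r.castSucc g.val ^ (w r.castSucc - w r.succ).toNat) *
    g.val.det ^ w (Fin.last ℓ)

theorem highestWeightFun_one (w : Fin (ℓ + 1) → ℤ) :
    highestWeightFun w (1 : GL (Fin (ℓ + 1)) K) = 1 := by
  simp [highestWeightFun, leadingMinor_one]

theorem highestWeightFun_mem_representativeFun (w : Fin (ℓ + 1) → ℤ) :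
    highestWeightFun w ∈ representativeFun (regularFun (Fin (ℓ + 1)) K) := by
  have hdet : (fun g : GL (Fin (ℓ + 1)) K => g.val.det ^ w (Fin.last ℓ)) ∈
      representativeFun (regularFun (Fin (ℓ + 1)) K) :=
    mem_representativeFun_of_mul (det_zpow_mem_regularFun _) fun x g => by
      rw [Units.val_mul, Matrix.det_mul, mul_zpow]
  have hminors := Subalgebra.prod_mem (representativeFun (regularFun (Fin (ℓ + 1)) K))
    (t := Finset.univ) fun (r : Fin ℓ) _ => Subalgebra.pow_mem _
      (leadingMinor_mem_representativeFun (K := K) r.castSucc) (w r.castSucc - w r.succ).toNat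
  convert Subalgebra.mul_mem _ hminors hdet using 1
  ext g
  rw [highestWeightFun, Pi.mul_apply, Finset.prod_apply]
  rfl

theorem highestWeightFun_mul {w : Fin (ℓ + 1) → ℤ} (hw : Antitone w) (x : GL (Fin (ℓ + 1)) K)
    {b : GL (Fin (ℓ + 1)) K} (hb : b.val.IsUpperTriangular) :
    highestWeightFun w (x * b) = (∏ i, b.val i i ^ w i) * highestWeightFun w x := by
  have hdet := Matrix.det_of_isUpperTriangular hb
  have hdiag (i : Fin (ℓ + 1)) : b.val i i ≠ 0 :=
    Finset.prod_ne_zero_iff.mp (hdet.symm.trans_ne b.det_ne_zero) i (Finset.mem_univ i)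
  simp only [highestWeightFun, Units.val_mul, leadingMinor_mul _ _ hb,
    leadingMinor_of_isUpperTriangular _ hb, Matrix.det_mul, mul_pow, mul_zpow,
    Finset.prod_mul_distrib, prod_zpow_eq_of_antitone hw hdiag, hdet]
  ring

end HighestWeightFunction

theorem exists_isIrrepOfHighestWeight {ℓ : ℕ} {w : Fin (ℓ + 1) → ℤ} (hw : Antitone w) :
    ∃ (V : Type) (_ : AddCommGroup V) (_ : Module ℂ V)
      (ρ : Representation ℂ (GL (Fin (ℓ + 1)) ℂ) V), IsIrrepOfHighestWeight ρ w := by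
  have hf := highestWeightFun_mem_representativeFun (K := ℂ) w
  have := finiteDimensional_orbitSpan_rightRegular hf
  have hne : highestWeightFun (K := ℂ) w ≠ 0 := fun h =>
    one_ne_zero ((highestWeightFun_one w).symm.trans (congrFun h 1))
  obtain ⟨N, hN⟩ := exists_isIrrepOfHighestWeight_quotient (isRational_orbitSpan_rightRegular hf)
    (Subtype.coe_ne_coe.mp hne) (orbitSpan_orbitSpan _ _)
    fun b hb => Subtype.ext (funext fun x => highestWeightFun_mul hw x hb)
  exact ⟨_, _, _, _, hN⟩

end QWhittaker

theorem mainTheorem4 (ℓ : ℕ) (p : Fin (ℓ + 1) → ℤ) (hp : Monotone p) :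
    (∀ (z : Fin (ℓ + 1) → ℂˣ) (lam : ℝ → Fin (ℓ + 1) → ℂ),
        (∀ᶠ q : ℝ in 𝓝[>] (0 : ℝ), ∀ i, (q : ℂ) ^ lam q i = z i) →
        Tendsto (fun q : ℝ => QWhittaker.qWhittakerFun ℓ q (lam q) p) (𝓝[>] (0 : ℝ))
          (𝓝 (QWhittaker.gzChar ℓ p z))) ∧
    (∀ r : ℕ, 1 ≤ r → r ≤ ℓ + 1 → ∀ z : Fin (ℓ + 1) → ℂˣ,
        QWhittaker.fundChar r z =
          ∑ I ∈ Finset.powersetCard r (Finset.univ : Finset (Fin (ℓ + 1))),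
            ∏ i ∈ I, (z i : ℂ) ∧
        QWhittaker.fundChar r z * QWhittaker.gzChar ℓ p z =
          ∑ I ∈ Finset.powersetCard r (Finset.univ : Finset (Fin (ℓ + 1))),
            QWhittaker.gzChar ℓ (QWhittaker.shift p I) z) ∧
    (∃ (V : Type) (_ : AddCommGroup V) (_ : Module ℂ V)
        (ρ : Representation ℂ (Matrix.GeneralLinearGroup (Fin (ℓ + 1)) ℂ) V),
        QWhittaker.IsIrrepOfHighestWeight ρ (fun i => p i.rev) ∧
        ∀ z : Fin (ℓ + 1) → ℂˣ,
          ρ.character (QWhittaker.torusElt z) = QWhittaker.gzChar ℓ p z) ∧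
    (∀ (V : Type*) [AddCommGroup V] [Module ℂ V]
        (ρ : Representation ℂ (Matrix.GeneralLinearGroup (Fin (ℓ + 1)) ℂ) V),
        QWhittaker.IsIrrepOfHighestWeight ρ (fun i => p i.rev) →
        ∀ z : Fin (ℓ + 1) → ℂˣ,
          ρ.character (QWhittaker.torusElt z) = QWhittaker.gzChar ℓ p z) := by
  refine ⟨fun z lam h => QWhittaker.tendsto_qWhittakerFun hp h,
    fun r _ _ z => ⟨QWhittaker.fundChar_eq r z, QWhittaker.fundChar_mul_gzChar hp r z⟩, ?_,
    fun V _ _ ρ h z => h.character_torusElt hp z⟩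
  obtain ⟨V, _, _, ρ, h⟩ := QWhittaker.exists_isIrrepOfHighestWeight (w := fun i => p i.rev)
    fun i j hij => hp (Fin.rev_le_rev.mpr hij)
  exact ⟨V, _, _, ρ, h, h.character_torusElt hp⟩
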